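/- Let $a<b$ and let $\psi\in C^2[a,b]$ be real-valued with $\psi'>0$ on $[a,b]$. Put $\kappa=2/(\psi(b)-\psi(a))$, $\mathrm d\psi=\psi'(x)\,\mathrm dx$, $\delta_\psi=\frac1{\psi'}\frac{\mathrm d}{\mathrm dx}$ (understood in the weak sense, $\delta_\psi^0=\mathrm{id}$, $\delta_\psi^{k}=\delta_\psi\delta_\psi^{k-1}$), and $$\varpi^{\alpha,\beta}(x)=\kappa^{\alpha+\beta+1}(\psi(b)-\psi(x))^{\alpha}(\psi(x)-\psi(a))^{\beta}\psi'(x),\qquad \|g\|_{\varpi^{\alpha,\beta}}=\Big(\int_a^b|g|^2\varpi^{\alpha,\beta}\,\mathrm dx\Big)^{1/2}.$$ Write $(g,h)_\psi=\int_a^b gh\,\mathrm d\psi$ and $(g,h)_{\varpi^{0,0}}=\int_a^b gh\,\varpi^{0,0}\mathrm dx=\kappa\,(g,h)_\psi$. Let $H^1_{0,\psi}(a,b)$ be the space of absolutely continuous $v$ on $[a,b]$ with $\int_a^b|\delta_\psi v|^2\,\mathrm d\psi<\infty$ and $v(a)=v(b)=0$, and let $H^{-1}_\psi(a,b)$ be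 its dual, the pairing being written $(f,w)_\psi$ (and $(f,w)_{\varpi^{0,0}}=\kappa(f,w)_\psi$). Let $$B^m_{\alpha,\beta}(a,b)=\{v:\ \|\delta_\psi^k v\|_{\varpi^{\alpha+k,\beta+k}}<\infty,\ 0\le k\le m\}.$$ For $\sigma>0$ let ${}_\psi\mathrm D^{-\sigma}_{a,x}u(x)=\frac1{\Gamma(\sigma)}\int_a^x\psi'(\tau)(\psi(x)-\psi(\tau))^{\sigma-1}u(\tau)\,\mathrm d\tau$, and for $n-1<\nu<n$ ($n\ge 1$ an integer) let ${}_\psi\mathrm D^{\nu}_{a,x}u=\delta_\psi^n\big[{}_\psi\mathrm D^{-(n-\nu)}_{a,x}u\big]$. For $N\ge 0$ let $F^\psi_N=\operatorname{span}\{1,\psi,\dots,\psi^N\}$, and for $N\ge1$ and $1<\mu<2$ let $V_N^0=F_N^\psi\cap H^1_{0,\psi}(a,b)$ and $$U_N=\{\phi=(\psi-\psi(a))^{\mu-1}\varphi:\ \varphi\in F^\psi_{N-1},\ {}_\psi\mathrm D^{-(2-\mu)}_{a,x}\phi(b)=0\}.$$ **Theorem.** For every integer $m\ge1$ there is a constant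 $C>0$, depending only on $a,b,\psi,m$, such that the following holds for all $1<\mu<2$, all integers $N\ge1$ with $m\le N+1$, and all $f\in H^{-1}_\psi(a,b)$. Let $u\in L^1_\psi(a,b)$ be the solution of the weak problem: $v:={}_\psi\mathrm D^{-(2-\mu)}_{a,x}u\in H^1_{0,\psi}(a,b)$ and $$(\delta_\psi v,\delta_\psi w)_\psi=-(f,w)_\psi\qquad\forall w\in H^1_{0,\psi}(a,b),$$ and let $u_N\in U_N$ be the Petrov–Galerkin solution: with $v_N:={}_\psi\mathrm D^{-(2-\mu)}_{a,x}u_N$ (so that $\delta_\psi v_N={}_\psi\mathrm D^{\mu-1}_{a,x}u_N$), $$(\delta_\psi v_N,\delta_\psi w)_{\varpi^{0,0}}=-(f,w)_{\varpi^{0,0}}\qquad\forall w\in V_N^0.$$ 1. If $\delta_\psi v\in B^{m-1}_{0,0}(a,b)$, then $$\|{}_\psi\mathrm D^{\mu-1}_{a,x}(u-u_N)\|_{\varpi^{0,0}}\le C\,N^{1-m}\,\|{}_\psi\mathrm D^{m+\mu-2}_{a,x}u\|_{\varpi^{m-1,m-1}}<\infty .$$ 2. If $m\ge2$ and $f$ is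 given by a function $f\in B^{m-2}_{0,0}(a,b)$, then $$\|{}_\psi\mathrm D^{\mu-1}_{a,x}(u-u_N)\|_{\varpi^{0,0}}\le C\,N^{1-m}\,\|\delta_\psi^{m-2}f\|_{\varpi^{m-1,m-1}}<\infty .$$ -/

import Mathlib

open MeasureTheory Set

noncomputable section

namespace PsiFrac

/-- The constant `κ = 2 / (ψ(b) - ψ(a))`. -/
def kappa (ψ : ℝ → ℝ) (a b : ℝ) : ℝ := 2 / (ψ b - ψ a)

/-- The measure `dψ = ψ'(x) dx` on `(a, b)`. -/
def psiMeasure (ψ : ℝ → ℝ) (a b : ℝ) : Measure ℝ :=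
  (volume.restrict (Ioo a b)).withDensity fun x => ENNReal.ofReal (deriv ψ x)

/-- The measure `ϖ^{α,β}(x) dx` on `(a, b)`, with the mapped Jacobi weight
`ϖ^{α,β}(x) = κ^{α+β+1} (ψ(b) - ψ(x))^α (ψ(x) - ψ(a))^β ψ'(x)`. -/
def weightMeasure (ψ : ℝ → ℝ) (a b α β : ℝ) : Measure ℝ :=
  (volume.restrict (Ioo a b)).withDensity fun x =>
    ENNReal.ofReal
      (kappa ψ a b ^ (α + β + 1) * (ψ b - ψ x) ^ α * (ψ x - ψ a) ^ β * deriv ψ x)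

/-- The norm `‖g‖_{ϖ^{α,β}}`, with value `∞` when `g` is not in `L²_{ϖ^{α,β}}(a, b)`. -/
def weightNorm (ψ : ℝ → ℝ) (a b α β : ℝ) (g : ℝ → ℝ) : ENNReal :=
  eLpNorm g 2 (weightMeasure ψ a b α β)

/-- The operator `δ_ψ = (1/ψ') d/dx`. -/
def delta (ψ : ℝ → ℝ) (f : ℝ → ℝ) (x : ℝ) : ℝ := deriv f x / deriv ψ x

/-- `g = δ_ψ f` on `(a, b)` in the weak (Sobolev) sense, for classes of functions modulo null
sets: `f` has a representative `F` which is absolutely continuous on every compact subinterval of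
`(a, b)`, and `δ_ψ F`, which exists almost everywhere, is `g`. In one dimension this is the same
as: `g` is locally integrable and is the distributional derivative of `f` with respect to `ψ`. -/
def IsDelta (ψ : ℝ → ℝ) (a b : ℝ) (f g : ℝ → ℝ) : Prop :=
  ∃ F : ℝ → ℝ, f =ᵐ[volume.restrict (Ioo a b)] F ∧
    (∀ x ∈ Ioo a b, ∀ y ∈ Ioo a b, AbsolutelyContinuousOnInterval F x y) ∧
    g =ᵐ[volume.restrict (Ioo a b)] delta ψ F

/-- `g = δ_ψ^k f` on `(a, b)` in the weak sense, with `δ_ψ^0 f = f` and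
`δ_ψ^{k+1} f = δ_ψ (δ_ψ^k f)`. -/
def IsDeltaIter (ψ : ℝ → ℝ) (a b : ℝ) : ℕ → (ℝ → ℝ) → (ℝ → ℝ) → Prop
  | 0, f, g => f =ᵐ[volume.restrict (Ioo a b)] g
  | k + 1, f, g => ∃ h, IsDeltaIter ψ a b k f h ∧ IsDelta ψ a b h g

/-- The non-uniformly mapped Jacobi-weighted Sobolev space `B^m_{α,β}(a, b)`:
`δ_ψ^k v ∈ L²_{ϖ^{α+k,β+k}}(a, b)` for `0 ≤ k ≤ m`. -/
def MemB (ψ : ℝ → ℝ) (a b : ℝ) (m : ℕ) (α β : ℝ) (v : ℝ → ℝ) : Prop :=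
  ∀ k : ℕ, k ≤ m → ∃ g, IsDeltaIter ψ a b k v g ∧
    MemLp g 2 (weightMeasure ψ a b (α + k) (β + k))

/-- The left-sided `ψ`-fractional integral of order `σ > 0` (the operator `_ψD_{a,x}^{-σ}`). -/
def psiInt (ψ : ℝ → ℝ) (a σ : ℝ) (f : ℝ → ℝ) (x : ℝ) : ℝ :=
  1 / Real.Gamma σ * ∫ τ in a..x, deriv ψ τ * (ψ x - ψ τ) ^ (σ - 1) * f τ

/-- `g = _ψD_{a,x}^ν u` on `(a, b)`, the left-sided `ψ`-Riemann-Liouville derivative of order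
`ν > 0`: `g = δ_ψ^n (_ψD_{a,x}^{-(n-ν)} u)` where `n - 1 ≤ ν < n`. -/
def IsRLDeriv (ψ : ℝ → ℝ) (a b ν : ℝ) (u g : ℝ → ℝ) : Prop :=
  IsDeltaIter ψ a b (⌊ν⌋₊ + 1) (psiInt ψ a (((⌊ν⌋₊ + 1 : ℕ) : ℝ) - ν) u) g

/-- Additivity of `δ_ψ` on absolutely continuous functions. -/
theorem delta_add_ae (ψ : ℝ → ℝ) {a b : ℝ} {v w : ℝ → ℝ}
    (hv : AbsolutelyContinuousOnInterval v a b) (hw : AbsolutelyContinuousOnInterval w a b) :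
    ∀ᵐ x ∂(volume.restrict (Ioo a b)), delta ψ (v + w) x = delta ψ v x + delta ψ w x := by
  rw [ae_restrict_iff' measurableSet_Ioo]
  filter_upwards [hv.ae_differentiableAt, hw.ae_differentiableAt] with x h1 h2 hx
  have hx' : x ∈ uIcc a b := Icc_subset_uIcc (Ioo_subset_Icc_self hx)
  simp only [delta]
  rw [deriv_add (h1 hx') (h2 hx'), add_div]

/-- The space `H^1_{0,ψ}(a, b)` of absolutely continuous `v` on `[a, b]` with
`δ_ψ v ∈ L²_ψ(a, b)` and `v(a) = v(b) = 0`. The values of `v` outside `[a, b]` play no role. -/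
def H10 (ψ : ℝ → ℝ) (a b : ℝ) : Submodule ℝ (ℝ → ℝ) where
  carrier := {v | AbsolutelyContinuousOnInterval v a b ∧
    MemLp (delta ψ v) 2 (psiMeasure ψ a b) ∧ v a = 0 ∧ v b = 0}
  zero_mem' := by
    refine ⟨?_, ?_, rfl, rfl⟩
    · exact (contDiff_const (c := (0 : ℝ))).contDiffOn.absolutelyContinuousOnInterval
    · have : delta ψ 0 = 0 := by
        funext x
        have h : deriv (0 : ℝ → ℝ) x = 0 := by
          rw [show (0 : ℝ → ℝ) = fun _ => (0 : ℝ) from rfl]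
          exact deriv_const x 0
        simp [delta, h]
      rw [this]
      exact MemLp.zero
  add_mem' := by
    rintro v w ⟨hv, hv2, hva, hvb⟩ ⟨hw, hw2, hwa, hwb⟩
    refine ⟨hv.add hw, ?_, by simp [hva, hwa], by simp [hvb, hwb]⟩
    refine MemLp.ae_eq ?_ (hv2.add hw2)
    refine (withDensity_absolutelyContinuous _ _).ae_le ?_
    filter_upwards [delta_add_ae ψ hv hw] with x hx
    exact hx.symm
  smul_mem' := by
    rintro c v ⟨hv, hv2, hva, hvb⟩
    refine ⟨hv.const_mul c, ?_, by simp [hva], by simp [hvb]⟩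
    have : delta ψ (c • v) = c • delta ψ v := by
      funext x
      simp [delta, deriv_const_smul_field, mul_div_assoc]
    rw [this]
    exact hv2.const_smul c

/-- The space `H^{-1}_ψ(a, b)`: the continuous linear functionals on `H^1_{0,ψ}(a, b)`, which is
normed by `‖w‖_ψ + ‖δ_ψ w‖_ψ`. The value `f w` is the pairing `(f, w)_ψ`. -/
def HNegOne (ψ : ℝ → ℝ) (a b : ℝ) : Set (Module.Dual ℝ (H10 ψ a b)) :=
  {f | ∃ K : ℝ, ∀ w : H10 ψ a b,
    |f w| ≤ K * ((eLpNorm (w : ℝ → ℝ) 2 (psiMeasure ψ a b)).toReal +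
      (eLpNorm (delta ψ w) 2 (psiMeasure ψ a b)).toReal)}

/-- `f ∈ H^{-1}_ψ` is given by the function `f₀`, that is `(f, w)_ψ = ∫ f₀ w dψ`. -/
def Represents (ψ : ℝ → ℝ) (a b : ℝ) (f₀ : ℝ → ℝ) (f : Module.Dual ℝ (H10 ψ a b)) : Prop :=
  ∀ w : H10 ψ a b, f w = ∫ x, f₀ x * (w : ℝ → ℝ) x ∂(psiMeasure ψ a b)

/-- `u ∈ L¹_ψ(a, b)` is the solution of the weak form of the linear boundary value problem of order
`μ` with right-hand side `f`: the function `v = _ψD_{a,x}^{-(2-μ)} u` is in `H^1_{0,ψ}(a, b)` and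
`(δ_ψ v, δ_ψ w)_ψ = -(f, w)_ψ` for all `w ∈ H^1_{0,ψ}(a, b)`. Here `v` is the absolutely
continuous representative of `_ψD_{a,x}^{-(2-μ)} u`. -/
def IsWeakSolution (ψ : ℝ → ℝ) (a b μ : ℝ) (f : Module.Dual ℝ (H10 ψ a b))
    (u v : ℝ → ℝ) : Prop :=
  Integrable u (psiMeasure ψ a b) ∧ v ∈ H10 ψ a b ∧
    psiInt ψ a (2 - μ) u =ᵐ[volume.restrict (Ioo a b)] v ∧
    ∀ w : H10 ψ a b, ∫ x, delta ψ v x * delta ψ w x ∂(psiMeasure ψ a b) = -f w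

/-- The space `F_N^ψ = span {1, ψ, …, ψ^N}`. -/
def FSpace (ψ : ℝ → ℝ) (N : ℕ) : Submodule ℝ (ℝ → ℝ) :=
  Submodule.span ℝ {p | ∃ i : ℕ, i ≤ N ∧ p = fun x => ψ x ^ i}

/-- The trial space `U_N` of all `φ = (ψ - ψ(a))^{μ-1} p` with `p ∈ F_{N-1}^ψ` and
`(_ψD_{a,x}^{-(2-μ)} φ)(b) = 0` (for `N ≥ 1`). -/
def USpace (ψ : ℝ → ℝ) (a b μ : ℝ) (N : ℕ) : Set (ℝ → ℝ) :=
  {φ | (∃ p ∈ FSpace ψ (N - 1), ∀ x ∈ Icc a b, φ x = (ψ x - ψ a) ^ (μ - 1) * p x) ∧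
    psiInt ψ a (2 - μ) φ b = 0}

/-- `uN ∈ U_N` is the solution of the Petrov-Galerkin scheme: with `v_N = _ψD_{a,x}^{-(2-μ)} u_N`,
one has `(δ_ψ v_N, δ_ψ w)_{ϖ^{0,0}} = -(f, w)_{ϖ^{0,0}}` for all
`w ∈ V_N^0 = F_N^ψ ∩ H^1_{0,ψ}(a, b)`. As `ϖ^{0,0} = κ ψ'`, the pairing `(f, w)_{ϖ^{0,0}}` is
`κ (f, w)_ψ`. By definition `δ_ψ v_N` is `_ψD_{a,x}^{μ-1} u_N`. -/
def IsPetrovGalerkin (ψ : ℝ → ℝ) (a b μ : ℝ) (N : ℕ) (f : Module.Dual ℝ (H10 ψ a b))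
    (uN : ℝ → ℝ) : Prop :=
  uN ∈ USpace ψ a b μ N ∧
    ∀ w : H10 ψ a b, (w : ℝ → ℝ) ∈ FSpace ψ N →
      ∫ x, delta ψ (psiInt ψ a (2 - μ) uN) x * delta ψ w x ∂(weightMeasure ψ a b 0 0) =
        -(kappa ψ a b * f w)

end PsiFrac

end

section

open Filter Topology Polynomial

/-! The scheme is an orthogonal projection in disguise. The fractional integral of order `2 - μ`
turns `(ψ - ψ(a))^{μ-1} p(ψ)` into a polynomial `V(ψ)` of one degree more, since after the
substitution `s = ψ - ψ(a)` only beta integrals occur (`exists_psiInt_eq_eval`). Hence `δ_ψ v_N =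
V'(ψ)` has degree `< N`. The functions `δ_ψ w` with `w ∈ V_N^0` are the polynomials in `ψ` of degree
`< N` with mean zero; constants are orthogonal to the residual as well, because `v` and `V(ψ)`
vanish at both endpoints. So `δ_ψ v_N` is the `L²_ψ` projection of `δ_ψ v` onto degree `< N`
(`exists_galerkin_projection`), and `μ` has left the problem.

It remains to bound the projection error of `g = δ_ψ v` by `h = δ_ψ^k g`, with `k = m - 1` and `W =
(ψ(b) - X)(X - ψ(a))`. The operator `T Q = (-1)^k (W^k Q^{(k)})^{(k)}` is symmetric, and the
Legendre polynomials, given by the Rodrigues formula, are its eigenfunctions with eigenvalues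
`(n+k)!/(n-k)!`, at least `c = N^{2k}/k^k` for `n ≥ N`. Any polynomial `Q` equals `T R` plus a
polynomial of degree `< N`, with `c ∫ (T R) R ≤ ∫ Q²`. Pairing the residual `e` with `Q`,
integrating by parts `k` times and applying Cauchy-Schwarz give `c (∫ e Q)² ≤ ‖h‖² ‖Q‖²`; the norm
of `h` carries the weight `W^k`. Density of polynomials in `ψ` allows `Q → e`
(`integral_residual_sq_le`). The integration by parts has no boundary terms, by an integrability
argument (`integral_delta_mul`).

For the second estimate, the weak equation gives `δ_ψ (δ_ψ v) = f₀` (`isDelta_delta_of_weak`), so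
that `h = δ_ψ^{m-2} f₀`. -/

/-! ### Vanishing boundary values from integrability. -/

/-- A function with a non-zero limit at `c` is not integrable near `c` after division by `x - c`. -/
theorem limit_eq_zero_of_integrableOn_div_sub {l : Filter ℝ} [NeBot l]
    [TendstoIxxClass Icc l l] {k : Set ℝ} {c L : ℝ} {Φ : ℝ → ℝ} (hk : k ∈ l) (hl : l ≤ 𝓝[≠] c)
    (hΦ : Tendsto Φ l (𝓝 L)) (hi : IntegrableOn (fun x => Φ x / (x - c)) k) : L = 0 := by
  by_contra hL
  have A : ∀ᶠ x in 𝓝[≠] c, HasDerivAt (fun x => Real.log (x - c)) (x - c)⁻¹ x := by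
    filter_upwards [self_mem_nhdsWithin] with x hx
    simpa using ((hasDerivAt_id x).sub_const c).log (sub_ne_zero.2 hx)
  have B : Tendsto (fun x => ‖Real.log (x - c)‖) (𝓝[≠] c) atTop := by
    refine tendsto_abs_atBot_atTop.comp (Real.tendsto_log_nhdsNE_zero.comp ?_)
    rw [← sub_self c]
    exact ((hasDerivAt_id c).sub_const c).tendsto_nhdsNE one_ne_zero
  -- `log (x - c)` is unbounded at `c`, and its derivative `1/(x - c)` is dominated by `Φ / (x - c)`
  -- as soon as `|Φ| > |L|/2`.
  refine not_integrableOn_of_tendsto_norm_atTop_of_deriv_isBigO_filter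
    (f := fun x => Real.log (x - c)) (g := fun x => Φ x / (x - c)) l hk
    ((A.filter_mono hl).mono fun x hx => hx.differentiableAt) (B.mono_left hl) ?_ hi
  have hpos : 0 < |L| / 2 := by positivity
  have hev : ∀ᶠ x in l, |L| / 2 < |Φ x| :=
    hΦ.abs.eventually (lt_mem_nhds (half_lt_self (abs_pos.2 hL)))
  refine Asymptotics.IsBigO.of_bound (|L| / 2)⁻¹ ?_
  filter_upwards [hev, A.filter_mono hl] with x hx h2
  rw [h2.deriv, norm_div, norm_inv, ← mul_div_assoc, div_eq_mul_inv (_ * _),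
    Real.norm_eq_abs (Φ x)]
  refine le_mul_of_one_le_left (by positivity) ?_
  rw [inv_mul_eq_div, le_div_iff₀ hpos]
  linarith

/-- If `F` has integrable derivative `f` on `(a, b)` and `F / ((x - a) (b - x))` is integrable,
then `F` vanishes at both endpoints, hence `∫ f = 0`. -/
theorem integral_Ioo_eq_zero_of_integrableOn_div {a b : ℝ} (hab : a < b) {F f : ℝ → ℝ}
    (hf : IntegrableOn f (Ioo a b))
    (hF : ∀ x ∈ Ioo a b, ∀ y ∈ Ioo a b, F y - F x = ∫ t in x..y, f t)
    (hG : IntegrableOn (fun x => F x / ((x - a) * (b - x))) (Ioo a b)) :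
    ∫ x in Ioo a b, f x = 0 := by
  obtain ⟨c, hc⟩ := nonempty_Ioo.2 hab
  have hfi : IntervalIntegrable f volume a b := by
    rwa [intervalIntegrable_iff_integrableOn_Ioo_of_le hab.le]
  have hca : c ∈ uIcc a b := Icc_subset_uIcc (Ioo_subset_Icc_self hc)
  have hcont := (hfi.absolutelyContinuousOnInterval_intervalIntegral hca).continuousOn
  rw [uIcc_of_le hab.le] at hcont
  -- `Φ` extends `F` continuously to the closed interval, which gives `F` limits at the endpoints.
  set Φ : ℝ → ℝ := fun x => F c + ∫ t in c..x, f t with hΦ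
  have hΦc : ContinuousOn Φ (Icc a b) := continuousOn_const.add hcont
  have hFΦ : ∀ x ∈ Ioo a b, F x = Φ x := fun x hx => by
    have := hF c hc x hx
    simp only [hΦ]; linarith
  -- Multiplying by `b - x` or `a - x` isolates the singularity at one endpoint.
  have hint : ∀ g : ℝ → ℝ, Continuous g →
      IntegrableOn (fun x => g x * (Φ x / ((x - a) * (b - x)))) (Ioo a b) := by
    intro g hg
    have h1 : IntegrableOn (fun x => Φ x / ((x - a) * (b - x))) (Ioo a b) :=
      hG.congr_fun (fun x hx => by simp only [hFΦ x hx]) measurableSet_Ioo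
    obtain ⟨C, hC⟩ := isCompact_Icc.exists_bound_of_continuousOn (s := Icc a b) hg.continuousOn
    refine Integrable.bdd_mul (c := C) h1 hg.aestronglyMeasurable ?_
    filter_upwards [ae_restrict_mem measurableSet_Ioo] with x hx
    exact hC x (Ioo_subset_Icc_self hx)
  have ha : Φ a = 0 := by
    refine limit_eq_zero_of_integrableOn_div_sub (l := 𝓝[>] a) (k := Ioo a b) (c := a) (Φ := Φ)
      (Ioo_mem_nhdsGT hab) (nhdsWithin_mono _ fun x hx => ne_of_gt hx) ?_ ?_
    · have := (hΦc a (left_mem_Icc.2 hab.le)).mono_left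
        (nhdsWithin_mono a (Ioo_subset_Icc_self (a := a) (b := b)))
      rwa [nhdsWithin_Ioo_eq_nhdsGT hab] at this
    · refine (hint (fun x => b - x) (by fun_prop)).congr_fun (fun x hx => ?_) measurableSet_Ioo
      have h1 : x - a ≠ 0 := (sub_pos.2 hx.1).ne'
      have h2 : b - x ≠ 0 := (sub_pos.2 hx.2).ne'
      simp only
      field_simp
  have hb : Φ b = 0 := by
    refine limit_eq_zero_of_integrableOn_div_sub (l := 𝓝[<] b) (k := Ioo a b) (c := b) (Φ := Φ)
      (Ioo_mem_nhdsLT hab) (nhdsWithin_mono _ fun x hx => ne_of_lt hx) ?_ ?_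
    · have := (hΦc b (right_mem_Icc.2 hab.le)).mono_left
        (nhdsWithin_mono b (Ioo_subset_Icc_self (a := a) (b := b)))
      rwa [nhdsWithin_Ioo_eq_nhdsLT hab] at this
    · refine (hint (fun x => a - x) (by fun_prop)).congr_fun (fun x hx => ?_) measurableSet_Ioo
      have h1 : x - a ≠ 0 := (sub_pos.2 hx.1).ne'
      have h2 : b - x ≠ 0 := (sub_pos.2 hx.2).ne'
      have h3 : x - b ≠ 0 := (sub_neg.2 hx.2).ne
      simp only
      field_simp
      ring
  have h1 : IntervalIntegrable f volume a c :=
    hfi.mono_set (uIcc_subset_uIcc left_mem_uIcc hca)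
  have h2 : IntervalIntegrable f volume c b :=
    hfi.mono_set (uIcc_subset_uIcc hca right_mem_uIcc)
  have h3 := intervalIntegral.integral_add_adjacent_intervals h1 h2
  rw [← integral_Ioc_eq_integral_Ioo, ← intervalIntegral.integral_of_le hab.le, ← h3,
    intervalIntegral.integral_symm]
  simp only [hΦ] at ha hb
  linarith

namespace PsiFrac

/-! ### Elementary properties of the change of variable `ψ`. -/

/-- The standing hypotheses on `ψ`. -/
structure Admissible (ψ : ℝ → ℝ) (a b : ℝ) : Prop where
  lt : a < b
  contDiffOn : ContDiffOn ℝ 2 ψ (Icc a b)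
  derivWithin_pos : ∀ x ∈ Icc a b, 0 < derivWithin ψ (Icc a b) x

namespace Admissible

variable {ψ : ℝ → ℝ} {a b : ℝ}

theorem continuousOn (A : Admissible ψ a b) : ContinuousOn ψ (Icc a b) :=
  A.contDiffOn.continuousOn

theorem deriv_eq (_A : Admissible ψ a b) {x : ℝ} (hx : x ∈ Ioo a b) :
    deriv ψ x = derivWithin ψ (Icc a b) x :=
  (derivWithin_of_mem_nhds (Icc_mem_nhds hx.1 hx.2)).symm

theorem deriv_pos (A : Admissible ψ a b) {x : ℝ} (hx : x ∈ Ioo a b) : 0 < deriv ψ x := by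
  rw [A.deriv_eq hx]
  exact A.derivWithin_pos x (Ioo_subset_Icc_self hx)

theorem hasDerivAt (A : Admissible ψ a b) {x : ℝ} (hx : x ∈ Ioo a b) :
    HasDerivAt ψ (deriv ψ x) x :=
  (differentiableAt_of_deriv_ne_zero (A.deriv_pos hx).ne').hasDerivAt

theorem exists_deriv_bounds (A : Admissible ψ a b) :
    ∃ c K : ℝ, 0 < c ∧ ∀ x ∈ Ioo a b, c ≤ deriv ψ x ∧ deriv ψ x ≤ K := by
  have hc : ContinuousOn (derivWithin ψ (Icc a b)) (Icc a b) :=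
    A.contDiffOn.continuousOn_derivWithin (uniqueDiffOn_Icc A.lt) (by norm_num)
  obtain ⟨x0, hx0, h0⟩ := isCompact_Icc.exists_isMinOn (nonempty_Icc.2 A.lt.le) hc
  obtain ⟨x1, hx1, h1⟩ := isCompact_Icc.exists_isMaxOn (nonempty_Icc.2 A.lt.le) hc
  refine ⟨_, derivWithin ψ (Icc a b) x1, A.derivWithin_pos x0 hx0, fun x hx => ?_⟩
  rw [A.deriv_eq hx]
  exact ⟨h0 (Ioo_subset_Icc_self hx), h1 (Ioo_subset_Icc_self hx)⟩

theorem continuousOn_deriv (A : Admissible ψ a b) : ContinuousOn (deriv ψ) (Ioo a b) := by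
  have hc : ContinuousOn (derivWithin ψ (Icc a b)) (Icc a b) :=
    A.contDiffOn.continuousOn_derivWithin (uniqueDiffOn_Icc A.lt) (by norm_num)
  exact (hc.mono Ioo_subset_Icc_self).congr fun x hx => A.deriv_eq hx

theorem strictMonoOn (A : Admissible ψ a b) : StrictMonoOn ψ (Icc a b) :=
  strictMonoOn_of_deriv_pos (convex_Icc a b) A.continuousOn fun x hx => by
    rw [interior_Icc] at hx
    exact A.deriv_pos hx

theorem psi_lt (A : Admissible ψ a b) : ψ a < ψ b :=
  A.strictMonoOn (left_mem_Icc.2 A.lt.le) (right_mem_Icc.2 A.lt.le) A.lt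

theorem psi_mem_Ioo (A : Admissible ψ a b) {x : ℝ} (hx : x ∈ Ioo a b) : ψ x ∈ Ioo (ψ a) (ψ b) :=
  ⟨A.strictMonoOn (left_mem_Icc.2 A.lt.le) (Ioo_subset_Icc_self hx) hx.1,
    A.strictMonoOn (Ioo_subset_Icc_self hx) (right_mem_Icc.2 A.lt.le) hx.2⟩

theorem kappa_pos (A : Admissible ψ a b) : 0 < kappa ψ a b :=
  div_pos two_pos (sub_pos.2 A.psi_lt)

/-- Lower Lipschitz bound. -/
theorem exists_mul_sub_le (A : Admissible ψ a b) :
    ∃ c : ℝ, 0 < c ∧ ∀ x ∈ Icc a b, ∀ y ∈ Icc a b, x ≤ y → c * (y - x) ≤ ψ y - ψ x := by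
  obtain ⟨c, K, hc, h⟩ := A.exists_deriv_bounds
  refine ⟨c, hc, fun x hx y hy hxy => ?_⟩
  refine (convex_Icc a b).mul_sub_le_image_sub_of_le_deriv A.continuousOn ?_ ?_ x hx y hy hxy
  · rw [interior_Icc]
    exact fun t ht => (A.hasDerivAt ht).differentiableAt.differentiableWithinAt
  · rw [interior_Icc]
    exact fun t ht => (h t ht).1

theorem contDiffOn_eval (A : Admissible ψ a b) (P : ℝ[X]) :
    ContDiffOn ℝ 1 (fun x => P.eval (ψ x)) (Icc a b) := by
  have h : ContDiff ℝ 1 (fun t : ℝ => P.eval t) := by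
    simpa using P.contDiff_aeval (𝕜 := ℝ) 1
  exact h.comp_contDiffOn (A.contDiffOn.of_le (by norm_num))

theorem continuousOn_eval (A : Admissible ψ a b) (P : ℝ[X]) :
    ContinuousOn (fun x => P.eval (ψ x)) (Icc a b) := (A.contDiffOn_eval P).continuousOn

theorem absolutelyContinuousOnInterval_eval (A : Admissible ψ a b) (P : ℝ[X]) :
    AbsolutelyContinuousOnInterval (fun x => P.eval (ψ x)) a b := by
  have := A.contDiffOn_eval P
  rw [← uIcc_of_le A.lt.le] at this
  exact this.absolutelyContinuousOnInterval

theorem hasDerivAt_eval (A : Admissible ψ a b) (P : ℝ[X]) {x : ℝ} (hx : x ∈ Ioo a b) :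
    HasDerivAt (fun x => P.eval (ψ x)) ((derivative P).eval (ψ x) * deriv ψ x) x :=
  (P.hasDerivAt (ψ x)).comp x (A.hasDerivAt hx)

theorem delta_eval (A : Admissible ψ a b) (P : ℝ[X]) {x : ℝ} (hx : x ∈ Ioo a b) :
    delta ψ (fun x => P.eval (ψ x)) x = (derivative P).eval (ψ x) := by
  rw [delta, (A.hasDerivAt_eval P hx).deriv, mul_div_cancel_right₀ _ (A.deriv_pos hx).ne']

theorem exists_bound_eval (A : Admissible ψ a b) (P : ℝ[X]) :
    ∃ C : ℝ, ∀ x ∈ Ioo a b, |P.eval (ψ x)| ≤ C := by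
  obtain ⟨C, hC⟩ := isCompact_Icc.exists_bound_of_continuousOn (A.continuousOn_eval P)
  exact ⟨C, fun x hx => hC x (Ioo_subset_Icc_self hx)⟩

end Admissible

/-! ### Jacobi weights with integer exponents and their `L²` spaces. -/

/-- The quadratic `(ψ(b) - X) (X - ψ(a))`. -/
noncomputable def quad (ψ : ℝ → ℝ) (a b : ℝ) : ℝ[X] := (C (ψ b) - X) * (X - C (ψ a))

/-- The measure with density `(ψ(b) - ψ)^k (ψ - ψ(a))^k ψ'` on `(a, b)`. -/
noncomputable def jacobiMeasure (ψ : ℝ → ℝ) (a b : ℝ) (k : ℕ) : Measure ℝ :=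
  (volume.restrict (Ioo a b)).withDensity fun x =>
    ENNReal.ofReal ((quad ψ a b).eval (ψ x) ^ k * deriv ψ x)

theorem psiMeasure_eq_jacobiMeasure (ψ : ℝ → ℝ) (a b : ℝ) :
    psiMeasure ψ a b = jacobiMeasure ψ a b 0 := by
  simp [psiMeasure, jacobiMeasure]

namespace Admissible

variable {ψ : ℝ → ℝ} {a b : ℝ}

theorem quad_pos (A : Admissible ψ a b) {x : ℝ} (hx : x ∈ Ioo a b) :
    0 < (quad ψ a b).eval (ψ x) := by
  have := A.psi_mem_Ioo hx
  simp only [quad, eval_mul, eval_sub, eval_C, eval_X]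
  exact mul_pos (sub_pos.2 this.2) (sub_pos.2 this.1)

theorem density_pos (A : Admissible ψ a b) (k : ℕ) {x : ℝ} (hx : x ∈ Ioo a b) :
    0 < (quad ψ a b).eval (ψ x) ^ k * deriv ψ x :=
  mul_pos (pow_pos (A.quad_pos hx) k) (A.deriv_pos hx)

theorem aemeasurable_density (A : Admissible ψ a b) (k : ℕ) :
    AEMeasurable (fun x => (quad ψ a b).eval (ψ x) ^ k * deriv ψ x)
      (volume.restrict (Ioo a b)) := by
  refine AEMeasurable.mul ?_ (measurable_deriv ψ).aemeasurable
  have := (A.continuousOn_eval (quad ψ a b ^ k)).mono Ioo_subset_Icc_self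
  simp only [eval_pow] at this
  exact this.aemeasurable measurableSet_Ioo

theorem integrable_jacobiMeasure_iff (A : Admissible ψ a b) (k : ℕ) {f : ℝ → ℝ} :
    Integrable f (jacobiMeasure ψ a b k) ↔
      IntegrableOn (fun x => (quad ψ a b).eval (ψ x) ^ k * deriv ψ x * f x) (Ioo a b) := by
  rw [jacobiMeasure, integrable_withDensity_iff_integrable_smul₀'
    (A.aemeasurable_density k).ennreal_ofReal (by simp), IntegrableOn]
  refine integrable_congr ?_
  filter_upwards [ae_restrict_mem measurableSet_Ioo] with x hx
  rw [ENNReal.toReal_ofReal (A.density_pos k hx).le, smul_eq_mul]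

theorem integral_jacobiMeasure (A : Admissible ψ a b) (k : ℕ) (f : ℝ → ℝ) :
    ∫ x, f x ∂(jacobiMeasure ψ a b k) =
      ∫ x in Ioo a b, (quad ψ a b).eval (ψ x) ^ k * deriv ψ x * f x := by
  rw [jacobiMeasure, integral_withDensity_eq_integral_toReal_smul₀
    (A.aemeasurable_density k).ennreal_ofReal (by simp)]
  refine integral_congr_ae ?_
  filter_upwards [ae_restrict_mem measurableSet_Ioo] with x hx
  rw [ENNReal.toReal_ofReal (A.density_pos k hx).le, smul_eq_mul]

theorem integrable_psiMeasure_iff (A : Admissible ψ a b) {f : ℝ → ℝ} :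
    Integrable f (psiMeasure ψ a b) ↔ IntegrableOn (fun x => deriv ψ x * f x) (Ioo a b) := by
  simpa [psiMeasure_eq_jacobiMeasure] using A.integrable_jacobiMeasure_iff 0

theorem integral_psiMeasure (A : Admissible ψ a b) (f : ℝ → ℝ) :
    ∫ x, f x ∂(psiMeasure ψ a b) = ∫ x in Ioo a b, deriv ψ x * f x := by
  simpa [psiMeasure_eq_jacobiMeasure] using A.integral_jacobiMeasure 0 f

theorem integrable_jacobiMeasure_iff_psiMeasure (A : Admissible ψ a b) (k : ℕ) {f : ℝ → ℝ} :
    Integrable f (jacobiMeasure ψ a b k) ↔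
      Integrable (fun x => (quad ψ a b ^ k).eval (ψ x) * f x) (psiMeasure ψ a b) := by
  rw [A.integrable_jacobiMeasure_iff, A.integrable_psiMeasure_iff]
  simp only [eval_pow, mul_left_comm (deriv ψ _), mul_assoc]

theorem integral_jacobiMeasure_eq (A : Admissible ψ a b) (k : ℕ) (f : ℝ → ℝ) :
    ∫ x, f x ∂(jacobiMeasure ψ a b k) =
      ∫ x, (quad ψ a b ^ k).eval (ψ x) * f x ∂(psiMeasure ψ a b) := by
  rw [A.integral_jacobiMeasure, A.integral_psiMeasure]
  simp only [eval_pow, mul_left_comm (deriv ψ _), mul_assoc]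

/-- The density is positive on the open interval, so all the weights share the null sets of Lebesgue
measure there and statements valid almost everywhere move freely between them. -/
theorem ae_jacobiMeasure_eq (A : Admissible ψ a b) (k : ℕ) :
    ae (jacobiMeasure ψ a b k) = ae (volume.restrict (Ioo a b)) := by
  refine le_antisymm (withDensity_absolutelyContinuous _ _).ae_le ?_
  refine (withDensity_absolutelyContinuous' (A.aemeasurable_density k).ennreal_ofReal ?_).ae_le
  filter_upwards [ae_restrict_mem measurableSet_Ioo] with x hx
  exact (ENNReal.ofReal_pos.2 (A.density_pos k hx)).ne'

theorem ae_psiMeasure_eq (A : Admissible ψ a b) :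
    ae (psiMeasure ψ a b) = ae (volume.restrict (Ioo a b)) := by
  rw [psiMeasure_eq_jacobiMeasure, A.ae_jacobiMeasure_eq]

theorem ae_mem_Ioo (A : Admissible ψ a b) (k : ℕ) : ∀ᵐ x ∂(jacobiMeasure ψ a b k), x ∈ Ioo a b := by
  rw [A.ae_jacobiMeasure_eq]
  exact ae_restrict_mem measurableSet_Ioo

theorem ae_psiMeasure_mem_Ioo (A : Admissible ψ a b) : ∀ᵐ x ∂(psiMeasure ψ a b), x ∈ Ioo a b := by
  rw [A.ae_psiMeasure_eq]
  exact ae_restrict_mem measurableSet_Ioo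

theorem exists_density_bound (A : Admissible ψ a b) (k : ℕ) :
    ∃ K : ℝ, ∀ x ∈ Ioo a b, (quad ψ a b).eval (ψ x) ^ k * deriv ψ x ≤ K := by
  obtain ⟨c, K, hc, h⟩ := A.exists_deriv_bounds
  obtain ⟨D, hD⟩ := A.exists_bound_eval (quad ψ a b ^ k)
  refine ⟨D * K, fun x hx => ?_⟩
  have h1 := hD x hx
  rw [eval_pow, abs_of_pos (pow_pos (A.quad_pos hx) k)] at h1
  exact mul_le_mul h1 (h x hx).2 (A.deriv_pos hx).le ((pow_pos (A.quad_pos hx) k).le.trans h1)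

theorem isFiniteMeasure_jacobiMeasure (A : Admissible ψ a b) (k : ℕ) :
    IsFiniteMeasure (jacobiMeasure ψ a b k) := by
  obtain ⟨K, hK⟩ := A.exists_density_bound k
  refine isFiniteMeasure_withDensity (ne_of_lt ?_)
  calc ∫⁻ x in Ioo a b, ENNReal.ofReal ((quad ψ a b).eval (ψ x) ^ k * deriv ψ x)
      ≤ ∫⁻ x in Ioo a b, ENNReal.ofReal K :=
        setLIntegral_mono measurable_const fun x hx => ENNReal.ofReal_le_ofReal (hK x hx)
    _ < ⊤ := by simp [ENNReal.mul_lt_top]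

theorem isFiniteMeasure_psiMeasure (A : Admissible ψ a b) :
    IsFiniteMeasure (psiMeasure ψ a b) := by
  rw [psiMeasure_eq_jacobiMeasure]
  exact A.isFiniteMeasure_jacobiMeasure 0

theorem aestronglyMeasurable_eval (A : Admissible ψ a b) (k : ℕ) (P : ℝ[X]) :
    AEStronglyMeasurable (fun x => P.eval (ψ x)) (jacobiMeasure ψ a b k) :=
  (((A.continuousOn_eval P).mono Ioo_subset_Icc_self).aestronglyMeasurable
    measurableSet_Ioo).mono_ac (withDensity_absolutelyContinuous _ _)

theorem memLp_eval (A : Admissible ψ a b) (k : ℕ) (P : ℝ[X]) :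
    MemLp (fun x => P.eval (ψ x)) 2 (jacobiMeasure ψ a b k) := by
  have := A.isFiniteMeasure_jacobiMeasure k
  obtain ⟨D, hD⟩ := A.exists_bound_eval P
  refine MemLp.of_bound (A.aestronglyMeasurable_eval k P) D ?_
  filter_upwards [A.ae_mem_Ioo k] with x hx using hD x hx

theorem integrable_eval_mul (A : Admissible ψ a b) (k : ℕ) (P : ℝ[X]) {f : ℝ → ℝ}
    (hf : Integrable f (jacobiMeasure ψ a b k)) :
    Integrable (fun x => P.eval (ψ x) * f x) (jacobiMeasure ψ a b k) := by
  obtain ⟨D, hD⟩ := A.exists_bound_eval P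
  refine hf.bdd_mul (c := D) (A.aestronglyMeasurable_eval k P) ?_
  filter_upwards [A.ae_mem_Ioo k] with x hx using hD x hx

theorem integrable_of_memLp (A : Admissible ψ a b) (k : ℕ) {f : ℝ → ℝ}
    (hf : MemLp f 2 (jacobiMeasure ψ a b k)) : Integrable f (jacobiMeasure ψ a b k) := by
  have := A.isFiniteMeasure_jacobiMeasure k
  exact hf.integrable (by norm_num)

/-- Raising the exponent of the weight. -/
theorem memLp_succ (A : Admissible ψ a b) (k : ℕ) {f : ℝ → ℝ}
    (hf : MemLp f 2 (jacobiMeasure ψ a b k)) : MemLp f 2 (jacobiMeasure ψ a b (k + 1)) := by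
  have hm : AEStronglyMeasurable f (jacobiMeasure ψ a b (k + 1)) :=
    hf.1.mono_ac (by
      intro s hs
      have := A.ae_jacobiMeasure_eq k
      rw [← A.ae_jacobiMeasure_eq (k + 1)] at this
      rw [← compl_compl s, ← mem_ae_iff] at hs ⊢
      rwa [← this])
  rw [memLp_two_iff_integrable_sq hm]
  have h := (memLp_two_iff_integrable_sq hf.1).1 hf
  have h2 := A.integrable_eval_mul k (quad ψ a b) h
  rw [A.integrable_jacobiMeasure_iff_psiMeasure] at h2 ⊢
  refine h2.congr (ae_of_all _ fun x => ?_)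
  simp only [eval_pow]
  ring

/-- Trades real exponents for integer ones. The exponent enters through an equation because it
arises in several forms, such as `0`, `0 + k` and `m - 1`. -/
theorem weightMeasure_eq (A : Admissible ψ a b) (k : ℕ) {α : ℝ} (hα : α = k) :
    weightMeasure ψ a b α α =
      ENNReal.ofReal (kappa ψ a b ^ (2 * k + 1)) • jacobiMeasure ψ a b k := by
  subst hα
  rw [weightMeasure, jacobiMeasure, ← withDensity_smul' _ _ ENNReal.ofReal_ne_top]
  · refine withDensity_congr_ae ?_
    filter_upwards [ae_restrict_mem measurableSet_Ioo] with x hx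
    rw [Pi.smul_apply, smul_eq_mul, ← ENNReal.ofReal_mul (pow_nonneg A.kappa_pos.le _)]
    congr 1
    have h1 : (k : ℝ) + k + 1 = ((2 * k + 1 : ℕ) : ℝ) := by push_cast; ring
    rw [h1, Real.rpow_natCast, Real.rpow_natCast, Real.rpow_natCast]
    simp only [quad, eval_mul, eval_sub, eval_C, eval_X, mul_pow]
    ring

theorem memLp_weightMeasure_iff (A : Admissible ψ a b) (k : ℕ) {α : ℝ} (hα : α = k) {f : ℝ → ℝ} :
    MemLp f 2 (weightMeasure ψ a b α α) ↔ MemLp f 2 (jacobiMeasure ψ a b k) := by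
  have hpos : 0 < kappa ψ a b ^ (2 * k + 1) := pow_pos A.kappa_pos _
  rw [A.weightMeasure_eq k hα]
  refine ⟨fun h => ?_, fun h => h.smul_measure ENNReal.ofReal_ne_top⟩
  have := h.smul_measure (c := (ENNReal.ofReal (kappa ψ a b ^ (2 * k + 1)))⁻¹)
    (ENNReal.inv_ne_top.2 (ENNReal.ofReal_pos.2 hpos).ne')
  rwa [smul_smul, ENNReal.inv_mul_cancel (ENNReal.ofReal_pos.2 hpos).ne' ENNReal.ofReal_ne_top,
    one_smul] at this

/-- The weighted norm in terms of a Bochner integral. -/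
theorem weightNorm_eq (A : Admissible ψ a b) (k : ℕ) {α : ℝ} (hα : α = k) {f : ℝ → ℝ}
    (hf : MemLp f 2 (jacobiMeasure ψ a b k)) :
    weightNorm ψ a b α α f = ENNReal.ofReal
      (Real.sqrt (kappa ψ a b ^ (2 * k + 1) * ∫ x, f x ^ 2 ∂(jacobiMeasure ψ a b k))) := by
  have hf' := (A.memLp_weightMeasure_iff k hα).2 hf
  rw [weightNorm, hf'.eLpNorm_eq_integral_rpow_norm (by norm_num) (by norm_num)]
  congr 1
  rw [A.weightMeasure_eq k hα, integral_smul_measure,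
    ENNReal.toReal_ofReal (pow_nonneg A.kappa_pos.le _), smul_eq_mul, Real.sqrt_eq_rpow]
  norm_num

end Admissible

/-- The Cauchy-Schwarz inequality in `L²`. -/
theorem sq_integral_mul_le {α : Type*} [MeasurableSpace α] {μ : Measure α} {f g : α → ℝ}
    (hf : MemLp f 2 μ) (hg : MemLp g 2 μ) :
    (∫ x, f x * g x ∂μ) ^ 2 ≤ (∫ x, f x ^ 2 ∂μ) * ∫ x, g x ^ 2 ∂μ := by
  have h1 := hf.integrable_sq
  have h2 := hg.integrable_sq
  have h3 : Integrable (fun x => f x * g x) μ := hf.integrable_mul hg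
  have key : ∀ t : ℝ, 0 ≤ (∫ x, g x ^ 2 ∂μ) * (t * t) + (2 * ∫ x, f x * g x ∂μ) * t +
      ∫ x, f x ^ 2 ∂μ := by
    intro t
    have : (∫ x, g x ^ 2 ∂μ) * (t * t) + (2 * ∫ x, f x * g x ∂μ) * t + ∫ x, f x ^ 2 ∂μ =
        ∫ x, (f x + t * g x) ^ 2 ∂μ := by
      have e : ∀ x, (f x + t * g x) ^ 2 =
          (t * t) * g x ^ 2 + (2 * t) * (f x * g x) + f x ^ 2 := fun x => by ring
      have i2 : Integrable (fun x => (t * t) * g x ^ 2 + (2 * t) * (f x * g x)) μ :=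
        (h2.const_mul _).add (h3.const_mul _)
      simp only [e]
      rw [integral_add i2 h1, integral_add (h2.const_mul _) (h3.const_mul _),
        integral_const_mul, integral_const_mul]
      ring
    rw [this]
    exact integral_nonneg fun x => sq_nonneg _
  have := discrim_le_zero key
  rw [discrim] at this
  nlinarith

variable {ψ : ℝ → ℝ} {a b : ℝ}

/-! ### Calculus of the weak operator `δ_ψ`. -/

theorem IsDelta.congr {f f' g g' : ℝ → ℝ} (h : IsDelta ψ a b f g)
    (hf : f =ᵐ[volume.restrict (Ioo a b)] f') (hg : g =ᵐ[volume.restrict (Ioo a b)] g') :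
    IsDelta ψ a b f' g' := by
  obtain ⟨F, h1, h2, h3⟩ := h
  exact ⟨F, hf.symm.trans h1, h2, hg.symm.trans h3⟩

theorem isDelta_of_absolutelyContinuousOnInterval {v : ℝ → ℝ}
    (hv : AbsolutelyContinuousOnInterval v a b) : IsDelta ψ a b v (delta ψ v) :=
  ⟨v, EventuallyEq.rfl, fun _ hx _ hy => hv.mono (uIcc_subset_uIcc
    (Icc_subset_uIcc (Ioo_subset_Icc_self hx)) (Icc_subset_uIcc (Ioo_subset_Icc_self hy))),
    EventuallyEq.rfl⟩

theorem continuousOn_of_locally_ac {F : ℝ → ℝ}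
    (hF : ∀ x ∈ Ioo a b, ∀ y ∈ Ioo a b, AbsolutelyContinuousOnInterval F x y) :
    ContinuousOn F (Ioo a b) := by
  intro x hx
  obtain ⟨c, hc1, hc2⟩ := exists_between hx.1
  obtain ⟨d, hd1, hd2⟩ := exists_between hx.2
  have h := (hF c ⟨hc1, hc2.trans hx.2⟩ d ⟨hx.1.trans hd1, hd2⟩).continuousOn
  rw [uIcc_of_le (hc2.trans hd1).le] at h
  exact (h.continuousAt (Icc_mem_nhds hc2 hd1)).continuousWithinAt

/-- Two continuous representatives that agree almost everywhere on an open interval agree everywhere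
on it, and so do their derivatives. -/
theorem IsDelta.unique {f g g' : ℝ → ℝ} (h : IsDelta ψ a b f g) (h' : IsDelta ψ a b f g') :
    g =ᵐ[volume.restrict (Ioo a b)] g' := by
  obtain ⟨F, h1, h2, h3⟩ := h
  obtain ⟨F', h1', h2', h3'⟩ := h'
  have heq : EqOn F F' (Ioo a b) :=
    Measure.eqOn_open_of_ae_eq (h1.symm.trans h1') isOpen_Ioo (continuousOn_of_locally_ac h2)
      (continuousOn_of_locally_ac h2')
  refine h3.trans (EventuallyEq.trans ?_ h3'.symm)
  filter_upwards [ae_restrict_mem measurableSet_Ioo] with x hx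
  have : F =ᶠ[𝓝 x] F' := heq.eventuallyEq_of_mem (isOpen_Ioo.mem_nhds hx)
  rw [delta, delta, this.deriv_eq]

theorem IsDeltaIter.congr {k : ℕ} {f f' g g' : ℝ → ℝ} (h : IsDeltaIter ψ a b k f g)
    (hf : f =ᵐ[volume.restrict (Ioo a b)] f') (hg : g =ᵐ[volume.restrict (Ioo a b)] g') :
    IsDeltaIter ψ a b k f' g' := by
  induction k generalizing g g' with
  | zero => exact hf.symm.trans (EventuallyEq.trans h hg)
  | succ k ih =>
    obtain ⟨p, h1, h2⟩ := h
    exact ⟨p, ih h1 EventuallyEq.rfl, h2.congr EventuallyEq.rfl hg⟩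

theorem IsDeltaIter.unique {k : ℕ} {f g g' : ℝ → ℝ} (h : IsDeltaIter ψ a b k f g)
    (h' : IsDeltaIter ψ a b k f g') : g =ᵐ[volume.restrict (Ioo a b)] g' := by
  induction k generalizing g g' with
  | zero => exact EventuallyEq.trans (EventuallyEq.symm h) h'
  | succ k ih =>
    obtain ⟨p, h1, h2⟩ := h
    obtain ⟨p', h1', h2'⟩ := h'
    exact h2.unique (h2'.congr (ih h1' h1) EventuallyEq.rfl)

/-- The definition of the iterates adds a new `δ_ψ` on the outside; here it is added on the inside,
as needed to pass from `v` to `δ_ψ v`. -/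
theorem IsDelta.iter_succ {k : ℕ} {f g h : ℝ → ℝ} (h1 : IsDelta ψ a b f g)
    (h2 : IsDeltaIter ψ a b k g h) : IsDeltaIter ψ a b (k + 1) f h := by
  induction k generalizing h with
  | zero => exact ⟨f, EventuallyEq.rfl, h1.congr EventuallyEq.rfl h2⟩
  | succ k ih =>
    obtain ⟨p, h3, h4⟩ := h2
    exact ⟨p, ih h3, h4⟩

theorem Admissible.isDelta_eval (A : Admissible ψ a b) (P : ℝ[X]) :
    IsDelta ψ a b (fun x => P.eval (ψ x)) (fun x => (derivative P).eval (ψ x)) := by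
  refine (isDelta_of_absolutelyContinuousOnInterval
    (A.absolutelyContinuousOnInterval_eval P)).congr EventuallyEq.rfl ?_
  filter_upwards [ae_restrict_mem measurableSet_Ioo] with x hx using A.delta_eval P hx

theorem Admissible.isDeltaIter_eval (A : Admissible ψ a b) (P : ℝ[X]) (k : ℕ) :
    IsDeltaIter ψ a b k (fun x => P.eval (ψ x)) (fun x => (derivative^[k] P).eval (ψ x)) := by
  induction k with
  | zero => exact EventuallyEq.rfl
  | succ k ih =>
    refine ⟨_, ih, ?_⟩
    rw [Function.iterate_succ_apply']
    exact A.isDelta_eval _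

/-! ### Integration by parts in the weighted spaces. -/

/-- Integration by parts against `R W^{j+1}`: the boundary terms vanish. -/
theorem Admissible.integral_delta_mul (A : Admissible ψ a b) (j : ℕ) {g h : ℝ → ℝ}
    (hgh : IsDelta ψ a b g h) (hg : MemLp g 2 (jacobiMeasure ψ a b j))
    (hh : MemLp h 2 (jacobiMeasure ψ a b (j + 1))) (R : ℝ[X]) :
    Integrable (fun x => (derivative (R * quad ψ a b ^ (j + 1))).eval (ψ x) * g x)
      (psiMeasure ψ a b) ∧
    ∫ x, (R * quad ψ a b ^ (j + 1)).eval (ψ x) * h x ∂(psiMeasure ψ a b) =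
      -∫ x, (derivative (R * quad ψ a b ^ (j + 1))).eval (ψ x) * g x ∂(psiMeasure ψ a b) := by
  set W := quad ψ a b with hW
  set P := R * W ^ (j + 1) with hP
  -- Differentiation costs only one factor `W`, and the remaining `W ^ j` is the weight under which
  -- `g` is square integrable.
  obtain ⟨R', hR'⟩ : ∃ R', derivative P = R' * W ^ j := by
    refine ⟨derivative R * W + R * ((j + 1 : ℕ) * derivative W), ?_⟩
    rw [hP, derivative_mul, derivative_pow_succ]
    simp only [map_natCast, Nat.cast_add, Nat.cast_one, map_add, map_one]
    ring
  have ig : ∀ S : ℝ[X], Integrable (fun x => (S * W ^ j).eval (ψ x) * g x) (psiMeasure ψ a b) := by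
    intro S
    have := A.integrable_eval_mul j S (A.integrable_of_memLp j hg)
    rw [A.integrable_jacobiMeasure_iff_psiMeasure] at this
    refine this.congr (ae_of_all _ fun x => ?_)
    simp only [eval_mul, ← hW]; ring
  have ih : Integrable (fun x => P.eval (ψ x) * h x) (psiMeasure ψ a b) := by
    have := A.integrable_eval_mul (j + 1) R (A.integrable_of_memLp (j + 1) hh)
    rw [A.integrable_jacobiMeasure_iff_psiMeasure] at this
    refine this.congr (ae_of_all _ fun x => ?_)
    simp only [hP, eval_mul, ← hW]; ring
  have ig' : Integrable (fun x => (derivative P).eval (ψ x) * g x) (psiMeasure ψ a b) := by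
    rw [hR']; exact ig R'
  refine ⟨ig', ?_⟩
  rw [eq_neg_iff_add_eq_zero, ← integral_add ih ig']
  obtain ⟨F, hgF, hF, hhF⟩ := hgh
  obtain ⟨c, K, hc, hcK⟩ := A.exists_deriv_bounds
  rw [A.integral_psiMeasure]
  have isum := A.integrable_psiMeasure_iff.1 (ih.add ig')
  have hae : ∀ᵐ x, x ∈ Ioo a b →
      g x = F x ∧ h x = delta ψ F x := by
    filter_upwards [(ae_restrict_iff' measurableSet_Ioo).1 hgF,
      (ae_restrict_iff' measurableSet_Ioo).1 hhF] with x h1 h2 hx using ⟨h1 hx, h2 hx⟩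
  refine integral_Ioo_eq_zero_of_integrableOn_div A.lt (F := fun x => P.eval (ψ x) * F x)
    isum ?_ ?_
  · intro x hx y hy
    have hsub : uIcc x y ⊆ Ioo a b := (ordConnected_Ioo).uIcc_subset hx hy
    have hP' : AbsolutelyContinuousOnInterval (fun x => P.eval (ψ x)) x y :=
      (A.absolutelyContinuousOnInterval_eval P).mono
        ((hsub.trans Ioo_subset_Icc_self).trans Icc_subset_uIcc)
    rw [← hP'.integral_deriv_mul_eq_sub (hF x hx y hy)]
    refine intervalIntegral.integral_congr_ae ?_
    filter_upwards [hae] with t ht htx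
    have htI := hsub (uIoc_subset_uIcc htx)
    rw [(A.hasDerivAt_eval P htI).deriv, (ht htI).1, (ht htI).2, delta]
    have := (A.deriv_pos htI).ne'
    field_simp
    ring
  -- The quotient to be integrated is `R W^j g ψ'` times `W / ((x - a)(b - x) ψ')`. The latter
  -- factor is at most `K * K / c`, by the bounds `c ≤ ψ' ≤ K`.
  · have h1 := (A.integrable_psiMeasure_iff).1 (ig R)
    have hK : 0 < K := by
      obtain ⟨x, hx⟩ := nonempty_Ioo.2 A.lt
      exact (A.deriv_pos hx).trans_le (hcK x hx).2
    have hq : ContinuousOn (fun x => W.eval (ψ x) / ((x - a) * (b - x)) / deriv ψ x) (Ioo a b) := by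
      refine ContinuousOn.div (ContinuousOn.div ?_ (by fun_prop) ?_) A.continuousOn_deriv ?_
      · exact (A.continuousOn_eval W).mono Ioo_subset_Icc_self
      · intro x hx
        exact (mul_pos (sub_pos.2 hx.1) (sub_pos.2 hx.2)).ne'
      · exact fun x hx => (A.deriv_pos hx).ne'
    have hup : ∀ x ∈ Icc a b, ∀ y ∈ Icc a b, x ≤ y → ψ y - ψ x ≤ K * (y - x) := by
      intro x hx y hy hxy
      refine (convex_Icc a b).image_sub_le_mul_sub_of_deriv_le A.continuousOn ?_ ?_ x hx y hy hxy
      · rw [interior_Icc]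
        exact fun t ht => (A.hasDerivAt ht).differentiableAt.differentiableWithinAt
      · rw [interior_Icc]
        exact fun t ht => (hcK t ht).2
    have h2 := Integrable.bdd_mul (c := K * K / c) h1
        (hq.aestronglyMeasurable measurableSet_Ioo) (by
      filter_upwards [ae_restrict_mem measurableSet_Ioo] with x hx
      have ha := sub_pos.2 hx.1
      have hb := sub_pos.2 hx.2
      have hxI := Ioo_subset_Icc_self hx
      have e1 := hup a (left_mem_Icc.2 A.lt.le) x hxI hx.1.le
      have e2 := hup x hxI b (right_mem_Icc.2 A.lt.le) hx.2.le
      have p1 := sub_pos.2 (A.psi_mem_Ioo hx).1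
      have p2 := sub_pos.2 (A.psi_mem_Ioo hx).2
      have hw := A.quad_pos hx
      have hd := A.deriv_pos hx
      rw [Real.norm_eq_abs, abs_of_pos (by positivity)]
      refine div_le_div₀ (by positivity) ?_ hc (hcK x hx).1
      rw [div_le_iff₀ (by positivity), hW, quad]
      simp only [eval_mul, eval_sub, eval_C, eval_X]
      calc (ψ b - ψ x) * (ψ x - ψ a) ≤ (K * (b - x)) * (K * (x - a)) :=
            mul_le_mul e2 e1 p1.le (by positivity)
        _ = _ := by ring)
    refine Integrable.congr h2 ?_
    filter_upwards [ae_restrict_mem measurableSet_Ioo,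
      (ae_restrict_iff' measurableSet_Ioo).2 hae] with x hx hx2
    have hd := (A.deriv_pos hx).ne'
    simp only [hP, hx2.1, eval_mul, eval_pow]
    rw [pow_succ]
    field_simp

/-- Repeated integration by parts. -/
theorem Admissible.integral_deltaIter_mul (A : Admissible ψ a b) (k : ℕ) {g h : ℝ → ℝ}
    (hg : ∀ j ≤ k, ∃ p, IsDeltaIter ψ a b j g p ∧ MemLp p 2 (jacobiMeasure ψ a b j))
    (hgh : IsDeltaIter ψ a b k g h) (R : ℝ[X]) :
    ∫ x, (R * quad ψ a b ^ k).eval (ψ x) * h x ∂(psiMeasure ψ a b) =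
      (-1) ^ k * ∫ x, (derivative^[k] (R * quad ψ a b ^ k)).eval (ψ x) * g x
        ∂(psiMeasure ψ a b) := by
  induction k generalizing h R with
  | zero =>
    rw [pow_zero, pow_zero, one_mul, Function.iterate_zero_apply]
    refine integral_congr_ae ?_
    rw [EventuallyEq, A.ae_psiMeasure_eq]
    filter_upwards [hgh] with x hx
    rw [hx]
  | succ k ih =>
    obtain ⟨p, hp, hph⟩ := hgh
    obtain ⟨p', hp', hL⟩ := hg k (Nat.le_succ k)
    obtain ⟨h', hh', hL'⟩ := hg (k + 1) le_rfl
    have e1 : MemLp p 2 (jacobiMeasure ψ a b k) := by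
      refine hL.ae_eq ?_
      rw [EventuallyEq, A.ae_jacobiMeasure_eq]
      exact hp'.unique hp
    have e2 : MemLp h 2 (jacobiMeasure ψ a b (k + 1)) := by
      refine hL'.ae_eq ?_
      rw [EventuallyEq, A.ae_jacobiMeasure_eq]
      exact hh'.unique ⟨p, hp, hph⟩
    have hstep := (A.integral_delta_mul k hph e1 e2 R).2
    obtain ⟨R', hR'⟩ : ∃ R', derivative (R * quad ψ a b ^ (k + 1)) = R' * quad ψ a b ^ k := by
      refine ⟨derivative R * quad ψ a b + R * ((k + 1 : ℕ) * derivative (quad ψ a b)), ?_⟩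
      rw [derivative_mul, derivative_pow_succ]
      simp only [map_natCast, Nat.cast_add, Nat.cast_one, map_add, map_one]
      ring
    rw [hstep, Function.iterate_succ_apply, hR',
      ih (fun j hj => hg j (hj.trans (Nat.le_succ k))) hp R']
    ring

/-! ### Legendre polynomials as eigenfunctions of a symmetric operator of order `2k`. -/

/-- The integral of `P ∘ ψ` with respect to `dψ`. -/
noncomputable def polyIntegral (ψ : ℝ → ℝ) (a b : ℝ) (P : ℝ[X]) : ℝ :=
  ∫ x, P.eval (ψ x) ∂(psiMeasure ψ a b)

/-- The Rodrigues polynomial of degree `n` (a multiple of the mapped Legendre polynomial). -/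
noncomputable def rodrigues (ψ : ℝ → ℝ) (a b : ℝ) (n : ℕ) : ℝ[X] :=
  derivative^[n] (quad ψ a b ^ n)

/-- The operator `Q ↦ (-1)^k (W^k Q^{(k)})^{(k)}`, symmetric with respect to `dψ`. -/
noncomputable def jacobiOp (ψ : ℝ → ℝ) (a b : ℝ) (k : ℕ) (Q : ℝ[X]) : ℝ[X] :=
  C ((-1) ^ k) * derivative^[k] (derivative^[k] Q * quad ψ a b ^ k)

/-- The eigenvalues of `jacobiOp`. -/
def jacobiEigenvalue (k n : ℕ) : ℕ := (n + k).descFactorial k * n.descFactorial k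

/-- The first falling factorial is at least `n^k`. The second is at least `(n - k + 1)^k`, and `n ≤
k (n - k + 1)` for `1 ≤ k ≤ n`; this is the source of `k^k`. -/
theorem pow_le_jacobiEigenvalue {k N n : ℕ} (hk : k ≤ N) (hn : N ≤ n) :
    N ^ (2 * k) ≤ k ^ k * jacobiEigenvalue k n := by
  have h1 : n ^ k ≤ (n + k).descFactorial k := by
    refine le_trans ?_ (Nat.pow_sub_le_descFactorial (n + k) k)
    exact Nat.pow_le_pow_left (by omega) k
  have h2 : n ^ k ≤ k ^ k * n.descFactorial k := by
    refine le_trans ?_ (Nat.mul_le_mul_left _ (Nat.pow_sub_le_descFactorial n k))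
    rw [← mul_pow]
    rcases Nat.eq_zero_or_pos k with rfl | hk0
    · simp
    · refine Nat.pow_le_pow_left ?_ k
      obtain ⟨d, rfl⟩ := Nat.exists_eq_add_of_le (hk.trans hn)
      obtain ⟨e, rfl⟩ := Nat.exists_eq_add_of_le hk0
      rw [show 1 + e + d + 1 - (1 + e) = d + 1 by omega]
      nlinarith [Nat.zero_le (e * d)]
  calc N ^ (2 * k) ≤ n ^ (2 * k) := Nat.pow_le_pow_left hn _
    _ = n ^ k * n ^ k := by rw [two_mul, pow_add]
    _ ≤ (n + k).descFactorial k * (k ^ k * n.descFactorial k) := Nat.mul_le_mul h1 h2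
    _ = _ := by rw [jacobiEigenvalue]; ring

theorem natDegree_quad_le : (quad ψ a b).natDegree ≤ 2 := by
  rw [quad]
  compute_degree

theorem coeff_quad_two : (quad ψ a b).coeff 2 = -1 := by
  rw [quad]
  have : (C (ψ b) - X) * (X - C (ψ a)) =
    -X ^ 2 + C (ψ a + ψ b) * X - C (ψ a * ψ b) := by
    simp only [C_add, C_mul]; ring
  rw [this]
  simp

theorem natDegree_quad_pow_le (k : ℕ) : (quad ψ a b ^ k).natDegree ≤ k * 2 :=
  natDegree_pow_le_of_le k natDegree_quad_le

theorem coeff_quad_pow (k : ℕ) : (quad ψ a b ^ k).coeff (k * 2) = (-1) ^ k := by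
  rw [coeff_pow_of_natDegree_le natDegree_quad_le, coeff_quad_two]

theorem natDegree_rodrigues_le (n : ℕ) : (rodrigues ψ a b n).natDegree ≤ n := by
  refine (natDegree_iterate_derivative _ n).trans ?_
  have := natDegree_quad_pow_le (ψ := ψ) (a := a) (b := b) n
  omega

theorem coeff_rodrigues_ne_zero (n : ℕ) : (rodrigues ψ a b n).coeff n ≠ 0 := by
  rw [rodrigues, coeff_iterate_derivative, ← mul_two, coeff_quad_pow, nsmul_eq_mul]
  refine mul_ne_zero (Nat.cast_ne_zero.2 ?_) (pow_ne_zero _ (by norm_num))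
  rw [Ne, Nat.descFactorial_eq_zero_iff_lt]
  omega

theorem natDegree_jacobiOp_le (k : ℕ) (Q : ℝ[X]) :
    (jacobiOp ψ a b k Q).natDegree ≤ Q.natDegree := by
  rw [jacobiOp]
  refine (natDegree_C_mul_le _ _).trans ((natDegree_iterate_derivative _ k).trans ?_)
  rcases lt_or_ge Q.natDegree k with h | h
  · simp [iterate_derivative_eq_zero h]
  · have h1 := natDegree_mul_le (p := derivative^[k] Q) (q := quad ψ a b ^ k)
    have h2 := natDegree_iterate_derivative Q k
    have h3 := natDegree_quad_pow_le (ψ := ψ) (a := a) (b := b) k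
    omega

theorem degree_jacobiOp_lt {k n : ℕ} {Q : ℝ[X]} (hQ : Q.degree < n) :
    (jacobiOp ψ a b k Q).degree < n := by
  rcases eq_or_ne Q 0 with rfl | h0
  · simp [jacobiOp]
  · rw [← natDegree_lt_iff_degree_lt h0] at hQ
    exact (degree_le_of_natDegree_le (natDegree_jacobiOp_le k Q)).trans_lt (by exact_mod_cast hQ)

/-- `jacobiOp` is triangular in the degree with these diagonal entries. The sign `(-1)^k`
compensates the leading coefficient of `quad ^ k`. -/
theorem coeff_jacobiOp {k n : ℕ} (hk : k ≤ n) {Q : ℝ[X]} (hQ : Q.natDegree ≤ n) :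
    (jacobiOp ψ a b k Q).coeff n = jacobiEigenvalue k n * Q.coeff n := by
  have h2 := natDegree_iterate_derivative Q k
  have e : n + k = (n - k) + k * 2 := by omega
  rw [jacobiOp, coeff_C_mul, coeff_iterate_derivative]
  conv_lhs => rw [show (derivative^[k] Q * quad ψ a b ^ k).coeff (n + k) =
    (derivative^[k] Q * quad ψ a b ^ k).coeff ((n - k) + k * 2) by rw [e]]
  rw [coeff_mul_add_eq_of_natDegree_le (by omega) (natDegree_quad_pow_le k), coeff_quad_pow,
    coeff_iterate_derivative, Nat.sub_add_cancel hk, jacobiEigenvalue, nsmul_eq_mul, nsmul_eq_mul]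
  push_cast
  have : ((-1 : ℝ) ^ k) * (-1) ^ k = 1 := by rw [← mul_pow]; simp
  linear_combination (((n + k).descFactorial k : ℝ) * n.descFactorial k * Q.coeff n) * this

theorem jacobiOp_add (k : ℕ) (P Q : ℝ[X]) :
    jacobiOp ψ a b k (P + Q) = jacobiOp ψ a b k P + jacobiOp ψ a b k Q := by
  simp only [jacobiOp, iterate_map_add, add_mul, mul_add]

theorem jacobiOp_C_mul (k : ℕ) (c : ℝ) (Q : ℝ[X]) :
    jacobiOp ψ a b k (C c * Q) = C c * jacobiOp ψ a b k Q := by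
  simp only [jacobiOp, iterate_derivative_C_mul, mul_assoc]
  ring

namespace Admissible

theorem integrable_eval (A : Admissible ψ a b) (P : ℝ[X]) :
    Integrable (fun x => P.eval (ψ x)) (psiMeasure ψ a b) := by
  rw [psiMeasure_eq_jacobiMeasure]
  exact A.integrable_of_memLp 0 (A.memLp_eval 0 P)

theorem polyIntegral_add (A : Admissible ψ a b) (P Q : ℝ[X]) :
    polyIntegral ψ a b (P + Q) = polyIntegral ψ a b P + polyIntegral ψ a b Q := by
  simp only [polyIntegral, eval_add]
  exact integral_add (A.integrable_eval P) (A.integrable_eval Q)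

theorem polyIntegral_C_mul (_A : Admissible ψ a b) (c : ℝ) (Q : ℝ[X]) :
    polyIntegral ψ a b (C c * Q) = c * polyIntegral ψ a b Q := by
  simp only [polyIntegral, eval_mul, eval_C]
  exact integral_const_mul _ _

theorem polyIntegral_sq_nonneg (_A : Admissible ψ a b) (Q : ℝ[X]) :
    0 ≤ polyIntegral ψ a b (Q * Q) := by
  refine integral_nonneg fun x => ?_
  simp only [eval_mul]
  exact mul_self_nonneg _

/-- A polynomial with zero norm vanishes on `ψ '' Ioo a b`, an infinite set. -/
theorem eq_zero_of_polyIntegral_sq (A : Admissible ψ a b) {Q : ℝ[X]}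
    (h : polyIntegral ψ a b (Q * Q) = 0) : Q = 0 := by
  rw [polyIntegral, integral_eq_zero_iff_of_nonneg (fun x => by
    simp only [eval_mul]; exact mul_self_nonneg _) (A.integrable_eval _), EventuallyEq,
    A.ae_psiMeasure_eq] at h
  have heq := Measure.eqOn_open_of_ae_eq h isOpen_Ioo
    ((A.continuousOn_eval _).mono Ioo_subset_Icc_self) continuousOn_const
  refine Q.eq_zero_of_infinite_isRoot ?_
  have hinf : (ψ '' Ioo a b).Infinite :=
    (Ioo_infinite A.lt).image (A.strictMonoOn.injOn.mono Ioo_subset_Icc_self)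
  refine hinf.mono ?_
  rintro _ ⟨x, hx, rfl⟩
  have := heq hx
  simp only [eval_mul, Pi.zero_apply, mul_self_eq_zero] at this
  exact this

theorem polyIntegral_iterate_derivative (A : Admissible ψ a b) (k : ℕ) (R Q : ℝ[X]) :
    polyIntegral ψ a b (R * quad ψ a b ^ k * derivative^[k] Q) =
      (-1) ^ k * polyIntegral ψ a b (derivative^[k] (R * quad ψ a b ^ k) * Q) := by
  have := A.integral_deltaIter_mul k
    (fun j _ => ⟨_, A.isDeltaIter_eval Q j, A.memLp_eval j _⟩) (A.isDeltaIter_eval Q k) R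
  simpa only [polyIntegral, eval_mul] using this

theorem polyIntegral_jacobiOp_mul (A : Admissible ψ a b) (k : ℕ) (P Q : ℝ[X]) :
    polyIntegral ψ a b (jacobiOp ψ a b k P * Q) =
      polyIntegral ψ a b (derivative^[k] P * quad ψ a b ^ k * derivative^[k] Q) := by
  rw [A.polyIntegral_iterate_derivative, jacobiOp, mul_assoc, A.polyIntegral_C_mul]

theorem polyIntegral_jacobiOp_symm (A : Admissible ψ a b) (k : ℕ) (P Q : ℝ[X]) :
    polyIntegral ψ a b (jacobiOp ψ a b k P * Q) = polyIntegral ψ a b (jacobiOp ψ a b k Q * P) := by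
  rw [A.polyIntegral_jacobiOp_mul, A.polyIntegral_jacobiOp_mul]
  congr 1
  ring

/-- Moving all `n` derivatives of the Rodrigues formula onto `Q` annihilates it. -/
theorem polyIntegral_rodrigues_mul (A : Admissible ψ a b) {n : ℕ} {Q : ℝ[X]} (hQ : Q.degree < n) :
    polyIntegral ψ a b (rodrigues ψ a b n * Q) = 0 := by
  rcases eq_or_ne Q 0 with rfl | h0
  · simp [polyIntegral]
  · rw [← natDegree_lt_iff_degree_lt h0] at hQ
    have h := A.polyIntegral_iterate_derivative n 1 Q
    rw [iterate_derivative_eq_zero hQ, one_mul, mul_zero, ← rodrigues] at h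
    have h1 : polyIntegral ψ a b 0 = 0 := by simp [polyIntegral]
    rw [h1] at h
    exact (mul_eq_zero.1 h.symm).resolve_left (pow_ne_zero _ (by norm_num))

/-- The Rodrigues polynomials are eigenfunctions of `jacobiOp`. -/
theorem jacobiOp_rodrigues (A : Admissible ψ a b) {k n : ℕ} (hk : k ≤ n) :
    jacobiOp ψ a b k (rodrigues ψ a b n) =
      C (jacobiEigenvalue k n : ℝ) * rodrigues ψ a b n := by
  set p := rodrigues ψ a b n with hp
  set D := jacobiOp ψ a b k p + C (-(jacobiEigenvalue k n : ℝ)) * p with hD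
  have hpn : p.natDegree ≤ n := natDegree_rodrigues_le n
  have hDn : D.degree < n := by
    rw [degree_lt_iff_coeff_zero]
    intro m hm
    rw [hD, coeff_add, coeff_C_mul]
    rcases hm.eq_or_lt with rfl | hm
    · rw [coeff_jacobiOp hk hpn]; ring
    · rw [coeff_eq_zero_of_natDegree_lt (((natDegree_jacobiOp_le k p).trans hpn).trans_lt hm),
        coeff_eq_zero_of_natDegree_lt (hpn.trans_lt hm)]
      ring
  -- By symmetry `∫ D² = ∫ (T D) p - λ ∫ p D`, where `λ` is the eigenvalue. Both terms vanish
  -- because `D` and `T D` have degree `< n`.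
  have h0 : D = 0 := by
    refine A.eq_zero_of_polyIntegral_sq ?_
    nth_rewrite 1 [hD]
    rw [add_mul, A.polyIntegral_add, A.polyIntegral_jacobiOp_symm, mul_comm _ p, mul_assoc,
      A.polyIntegral_C_mul, A.polyIntegral_rodrigues_mul (degree_jacobiOp_lt hDn),
      A.polyIntegral_rodrigues_mul hDn]
    ring
  rw [hD, C_neg, neg_mul] at h0
  exact add_neg_eq_zero.1 h0

/-- Modulo polynomials of degree `< N`, every polynomial is in the range of `jacobiOp`, with a
bound on the preimage given by the smallest eigenvalue. -/
theorem exists_jacobiOp_eq_sub (A : Admissible ψ a b) {k N : ℕ} (hk : k ≤ N) {c : ℝ}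
    (hc : 0 < c) (hcn : ∀ n, N ≤ n → c ≤ jacobiEigenvalue k n) (M : ℕ) :
    ∀ Q : ℝ[X], Q.degree < M → ∃ R Q₀ : ℝ[X], R.degree < M ∧ Q₀.degree < N ∧
      jacobiOp ψ a b k R = Q - Q₀ ∧
      (∀ S : ℝ[X], S.degree < N → polyIntegral ψ a b (jacobiOp ψ a b k R * S) = 0) ∧
      c * polyIntegral ψ a b (jacobiOp ψ a b k R * R) ≤ polyIntegral ψ a b (Q * Q) := by
  induction M with
  | zero =>
    intro Q hQ
    have hQ0 : Q = 0 := by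
      rw [← degree_eq_bot]
      simpa [Nat.WithBot.lt_zero_iff] using hQ
    subst hQ0
    refine ⟨0, 0, hQ, by simp, by simp [jacobiOp], fun S _ => by simp [jacobiOp, polyIntegral],
      by simp [polyIntegral]⟩
  | succ M ih =>
    intro Q hQ
    rcases lt_or_ge M N with hMN | hNM
    -- Below degree `N` nothing has to be inverted: all of `Q` goes into `Q₀`.
    · refine ⟨0, Q, by simp, hQ.trans_le (by exact_mod_cast hMN), by simp [jacobiOp],
        fun S _ => by simp [jacobiOp, polyIntegral], ?_⟩
      have := A.polyIntegral_sq_nonneg Q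
      simpa [polyIntegral] using this
    set p := rodrigues ψ a b M with hp
    have hpM : p.natDegree ≤ M := natDegree_rodrigues_le M
    have hpc : p.coeff M ≠ 0 := coeff_rodrigues_ne_zero M
    -- Subtracting `d p` removes the top degree. This summand is inverted by dividing by its
    -- eigenvalue `L ≥ c`, and orthogonality of `p` to lower degrees makes both quadratic forms
    -- split.
    set d := Q.coeff M / p.coeff M with hd
    set Q' := Q + C (-d) * p with hQ'
    have hQ'deg : Q'.degree < M := by
      rw [degree_lt_iff_coeff_zero]
      intro m hm
      rw [hQ', coeff_add, coeff_C_mul]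
      rcases hm.eq_or_lt with rfl | hm
      · rw [hd]; field_simp; ring
      · rw [coeff_eq_zero_of_natDegree_lt (hpM.trans_lt hm),
          (degree_lt_iff_coeff_zero Q _).1 hQ m hm]
        ring
    obtain ⟨R', Q₀, hR', hQ₀, hT, hort, hle⟩ := ih Q' hQ'deg
    set L : ℝ := ((jacobiEigenvalue k M : ℕ) : ℝ) with hL
    have hLc : c ≤ L := hcn M hNM
    have hLpos : 0 < L := hc.trans_le hLc
    have hTp : jacobiOp ψ a b k (C (d / L) * p) = C d * p := by
      rw [jacobiOp_C_mul, A.jacobiOp_rodrigues (hk.trans hNM), ← mul_assoc, ← C_mul,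
        div_mul_cancel₀ _ hLpos.ne']
    refine ⟨C (d / L) * p + R', Q₀, ?_, hQ₀, ?_, fun S hS => ?_, ?_⟩
    · refine (degree_add_le _ _).trans_lt (max_lt ?_
        (hR'.trans (by exact_mod_cast Nat.lt_succ_self M)))
      refine (degree_le_of_natDegree_le ((natDegree_C_mul_le _ _).trans hpM)).trans_lt ?_
      exact_mod_cast Nat.lt_succ_self M
    · rw [jacobiOp_add, hTp, hT, hQ', C_neg]
      ring
    · have hSM : S.degree < M := hS.trans_le (by exact_mod_cast hNM)
      rw [jacobiOp_add, hTp, add_mul, mul_assoc, A.polyIntegral_add, A.polyIntegral_C_mul,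
        A.polyIntegral_rodrigues_mul hSM, hort S hS]
      ring
    · rw [jacobiOp_add, hTp]
      have hQeq : Q = C d * p + Q' := by rw [hQ', C_neg]; ring
      have e1 : polyIntegral ψ a b ((C d * p + jacobiOp ψ a b k R') * (C (d / L) * p + R')) =
          d * (d / L) * polyIntegral ψ a b (p * p) +
            polyIntegral ψ a b (jacobiOp ψ a b k R' * R') := by
        have : (C d * p + jacobiOp ψ a b k R') * (C (d / L) * p + R') =
          C (d * (d / L)) * (p * p) + (C d * (p * R') + (C (d / L) * (p * jacobiOp ψ a b k R') +
            jacobiOp ψ a b k R' * R')) := by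
          rw [C_mul]; ring
        rw [this]
        simp only [A.polyIntegral_add, A.polyIntegral_C_mul]
        rw [hp, A.polyIntegral_rodrigues_mul hR',
          A.polyIntegral_rodrigues_mul (degree_jacobiOp_lt hR')]
        ring
      have e2 : polyIntegral ψ a b (Q * Q) =
          d * d * polyIntegral ψ a b (p * p) + polyIntegral ψ a b (Q' * Q') := by
        have : Q * Q = C (d * d) * (p * p) + (C (2 * d) * (p * Q') + Q' * Q') := by
          nth_rewrite 1 2 [hQeq]
          simp only [C_mul]
          rw [show (C 2 : ℝ[X]) = 2 from rfl]
          ring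
        rw [this]
        simp only [A.polyIntegral_add, A.polyIntegral_C_mul]
        rw [hp, A.polyIntegral_rodrigues_mul hQ'deg]
        ring
      rw [e1, e2, mul_add]
      refine add_le_add ?_ hle
      have h1 : c * (d * (d / L)) ≤ d * d := by
        have : c * (d * (d / L)) = (c / L) * (d * d) := by ring
        rw [this]
        exact mul_le_of_le_one_left (mul_self_nonneg d) ((div_le_one hLpos).2 hLc)
      rw [← mul_assoc]
      exact mul_le_mul_of_nonneg_right h1 (A.polyIntegral_sq_nonneg p)

end Admissible

/-! ### The projection error, by duality and density. -/

theorem integral_sq_le_of_eLpNorm_le {α : Type*} [MeasurableSpace α] {μ : Measure α} {f : α → ℝ}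
    (hf : MemLp f 2 μ) {η : ℝ} (hη : 0 ≤ η) (h : eLpNorm f 2 μ ≤ ENNReal.ofReal η) :
    ∫ x, f x ^ 2 ∂μ ≤ η ^ 2 := by
  rw [hf.eLpNorm_eq_integral_rpow_norm (by norm_num) (by norm_num),
    ENNReal.ofReal_le_ofReal_iff hη] at h
  have h0 : 0 ≤ ∫ x, f x ^ 2 ∂μ := integral_nonneg fun x => sq_nonneg _
  have h1 : Real.sqrt (∫ x, f x ^ 2 ∂μ) ≤ η := by
    rw [Real.sqrt_eq_rpow]
    convert h using 1
    norm_num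
  exact (Real.sqrt_le_left hη).1 h1

theorem integrable_mul_of_memLp_two {α : Type*} [MeasurableSpace α] {μ : Measure α} {f g : α → ℝ}
    (hf : MemLp f 2 μ) (hg : MemLp g 2 μ) : Integrable (fun x => f x * g x) μ :=
  hf.integrable_mul hg

namespace Admissible

/-- Stone-Weierstrass for the algebra generated by `ψ`, which separates points because `ψ` is
injective. -/
theorem exists_polynomial_near (A : Admissible ψ a b) {g : ℝ → ℝ} (hg : Continuous g) {δ : ℝ}
    (hδ : 0 < δ) : ∃ Q : ℝ[X], ∀ x ∈ Icc a b, |g x - Q.eval (ψ x)| ≤ δ := by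
  let Ψ : C(Icc a b, ℝ) := ⟨fun x => ψ x, A.continuousOn.domRestrict⟩
  let G : C(Icc a b, ℝ) := ⟨fun x => g x, by fun_prop⟩
  have hsep : (Polynomial.aeval (R := ℝ) Ψ).range.SeparatesPoints := by
    intro x y hxy
    refine ⟨Ψ, ⟨Ψ, ⟨X, by simp⟩, rfl⟩, fun h => hxy ?_⟩
    exact Subtype.ext (A.strictMonoOn.injOn x.2 y.2 h)
  obtain ⟨⟨q, Q, rfl⟩, hq⟩ :=
    ContinuousMap.exists_mem_subalgebra_near_continuousMap_of_separatesPoints _ hsep G δ hδ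
  refine ⟨Q, fun x hx => ?_⟩
  have h1 := (ContinuousMap.norm_coe_le_norm (aeval Ψ Q - G) ⟨x, hx⟩).trans hq.le
  rw [ContinuousMap.sub_apply, Polynomial.aeval_continuousMap_apply, Real.norm_eq_abs,
    abs_sub_comm] at h1
  exact h1

/-- Polynomials in `ψ` are dense in `L²_ψ`. -/
theorem exists_polynomial_integral_sq_le (A : Admissible ψ a b) {e : ℝ → ℝ}
    (he : MemLp e 2 (psiMeasure ψ a b)) {ε : ℝ} (hε : 0 < ε) :
    ∃ Q : ℝ[X], ∫ x, (e x - Q.eval (ψ x)) ^ 2 ∂(psiMeasure ψ a b) ≤ ε := by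
  have hfin := A.isFiniteMeasure_psiMeasure
  set μ := psiMeasure ψ a b with hμ
  -- Two squared errors of at most `ε/4` each suffice, as `(x + y)² ≤ 2x² + 2y²`.
  obtain ⟨g, hg, hgL⟩ := he.exists_boundedContinuous_eLpNorm_sub_le (by norm_num)
    (ε := ENNReal.ofReal (Real.sqrt (ε / 4))) (by simpa using hε)
  have h1 := integral_sq_le_of_eLpNorm_le (he.sub hgL) (Real.sqrt_nonneg _) hg
  rw [Real.sq_sqrt (by positivity)] at h1
  set V := μ.real univ with hV
  have hV0 : 0 ≤ V := measureReal_nonneg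
  obtain ⟨Q, hQ⟩ := A.exists_polynomial_near g.continuous
    (δ := Real.sqrt (ε / (4 * (V + 1)))) (Real.sqrt_pos.2 (by positivity))
  have hQL : MemLp (fun x => Q.eval (ψ x)) 2 μ := by
    rw [hμ, psiMeasure_eq_jacobiMeasure]; exact A.memLp_eval 0 Q
  have h2 : ∫ x, (g x - Q.eval (ψ x)) ^ 2 ∂μ ≤ ε / 4 := by
    have : ∫ x, (g x - Q.eval (ψ x)) ^ 2 ∂μ ≤ ∫ x, ε / (4 * (V + 1)) ∂μ := by
      refine integral_mono_ae (hgL.sub hQL).integrable_sq (integrable_const _) ?_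
      filter_upwards [A.ae_psiMeasure_mem_Ioo] with x hx
      have := hQ x (Ioo_subset_Icc_self hx)
      rw [← Real.sq_sqrt (show 0 ≤ ε / (4 * (V + 1)) by positivity), ← sq_abs]
      exact pow_le_pow_left₀ (abs_nonneg _) this 2
    refine this.trans ?_
    rw [integral_const, smul_eq_mul, ← hV]
    rw [mul_div_assoc', div_le_div_iff₀ (by positivity) (by positivity)]
    nlinarith
  refine ⟨Q, ?_⟩
  calc ∫ x, (e x - Q.eval (ψ x)) ^ 2 ∂μ
      ≤ ∫ x, (2 * (e - g) x ^ 2 + 2 * (g x - Q.eval (ψ x)) ^ 2) ∂μ := by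
        refine integral_mono (he.sub hQL).integrable_sq
          (((he.sub hgL).integrable_sq.const_mul 2).add
            ((hgL.sub hQL).integrable_sq.const_mul 2)) fun x => ?_
        simp only [Pi.sub_apply]
        nlinarith [sq_nonneg ((e x - g x) - (g x - Q.eval (ψ x)))]
    _ = 2 * ∫ x, (e - g) x ^ 2 ∂μ + 2 * ∫ x, (g x - Q.eval (ψ x)) ^ 2 ∂μ := by
        rw [← integral_const_mul, ← integral_const_mul]
        exact integral_add ((he.sub hgL).integrable_sq.const_mul 2)
          ((hgL.sub hQL).integrable_sq.const_mul 2)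
    _ ≤ ε := by linarith

/-- Duality estimate: the residual of `g` modulo polynomials in `ψ` of degree `< N` pairs with
polynomials as controlled by `δ_ψ^k g`. -/
theorem sq_integral_residual_mul_le (A : Admissible ψ a b) {k N : ℕ} (hk : k ≤ N) {c : ℝ}
    (hc : 0 < c) (hcn : ∀ n, N ≤ n → c ≤ jacobiEigenvalue k n) {g h : ℝ → ℝ} {P : ℝ[X]}
    (hg : ∀ j ≤ k, ∃ p, IsDeltaIter ψ a b j g p ∧ MemLp p 2 (jacobiMeasure ψ a b j))
    (hgh : IsDeltaIter ψ a b k g h) (hP : P.degree < N)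
    (hgL : MemLp g 2 (psiMeasure ψ a b)) (hhL : MemLp h 2 (jacobiMeasure ψ a b k))
    (horth : ∀ S : ℝ[X], S.degree < N →
      ∫ x, (g x - P.eval (ψ x)) * S.eval (ψ x) ∂(psiMeasure ψ a b) = 0) (Q : ℝ[X]) :
    c * (∫ x, (g x - P.eval (ψ x)) * Q.eval (ψ x) ∂(psiMeasure ψ a b)) ^ 2 ≤
      (∫ x, h x ^ 2 ∂(jacobiMeasure ψ a b k)) *
        ∫ x, Q.eval (ψ x) ^ 2 ∂(psiMeasure ψ a b) := by
  obtain ⟨R, Q₀, -, hQ₀, hT, hort, hle⟩ := A.exists_jacobiOp_eq_sub hk hc hcn (Q.natDegree + 1) Q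
    (degree_le_natDegree.trans_lt (by exact_mod_cast Nat.lt_succ_self _))
  set μ := psiMeasure ψ a b with hμ
  have hL : ∀ S : ℝ[X], MemLp (fun x => S.eval (ψ x)) 2 μ := fun S => by
    rw [hμ, psiMeasure_eq_jacobiMeasure]; exact A.memLp_eval 0 S
  have he : MemLp (fun x => g x - P.eval (ψ x)) 2 μ := hgL.sub (hL P)
  have h1 : ∫ x, (g x - P.eval (ψ x)) * Q.eval (ψ x) ∂μ =
      ∫ x, g x * (jacobiOp ψ a b k R).eval (ψ x) ∂μ := by
    have hQ : Q = jacobiOp ψ a b k R + Q₀ := by rw [hT]; ring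
    have e1 : ∫ x, (g x - P.eval (ψ x)) * Q.eval (ψ x) ∂μ =
        ∫ x, (g x - P.eval (ψ x)) * (jacobiOp ψ a b k R).eval (ψ x) ∂μ +
          ∫ x, (g x - P.eval (ψ x)) * Q₀.eval (ψ x) ∂μ := by
      rw [← integral_add (integrable_mul_of_memLp_two he (hL _))
        (integrable_mul_of_memLp_two he (hL _))]
      conv_lhs => rw [hQ]
      simp only [eval_add, mul_add]
    -- The part `Q₀` is invisible to the residual, and `P` is invisible to `jacobiOp R`; only `g`
    -- against `jacobiOp R` is left.
    rw [e1, horth Q₀ hQ₀, add_zero]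
    have e2 := hort P hP
    simp only [polyIntegral, eval_mul] at e2
    simp only [sub_mul]
    rw [integral_sub (integrable_mul_of_memLp_two hgL (hL _))
      (integrable_mul_of_memLp_two (hL P) (hL _)), sub_eq_self]
    simpa only [mul_comm] using e2
  have h2 : ∫ x, g x * (jacobiOp ψ a b k R).eval (ψ x) ∂μ =
      ∫ x, h x * (derivative^[k] R).eval (ψ x) ∂(jacobiMeasure ψ a b k) := by
    have := A.integral_deltaIter_mul k hg hgh (derivative^[k] R)
    rw [A.integral_jacobiMeasure_eq]
    have e3 : ∫ x, g x * (jacobiOp ψ a b k R).eval (ψ x) ∂μ =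
        (-1) ^ k * ∫ x, (derivative^[k] (derivative^[k] R * quad ψ a b ^ k)).eval (ψ x) * g x
          ∂μ := by
      rw [← integral_const_mul]
      refine integral_congr_ae (ae_of_all _ fun x => ?_)
      simp only [jacobiOp, eval_mul, eval_C]
      ring
    rw [e3, ← this]
    refine integral_congr_ae (ae_of_all _ fun x => ?_)
    simp only [eval_mul]
    ring
  have h3 := sq_integral_mul_le hhL (A.memLp_eval k (derivative^[k] R))
  have h4 : ∫ x, (derivative^[k] R).eval (ψ x) ^ 2 ∂(jacobiMeasure ψ a b k) =
      polyIntegral ψ a b (jacobiOp ψ a b k R * R) := by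
    rw [A.polyIntegral_jacobiOp_mul, A.integral_jacobiMeasure_eq, polyIntegral]
    refine integral_congr_ae (ae_of_all _ fun x => ?_)
    simp only [eval_mul]
    ring
  have h5 : polyIntegral ψ a b (Q * Q) = ∫ x, Q.eval (ψ x) ^ 2 ∂μ := by
    simp only [polyIntegral, eval_mul, sq, hμ]
  have hH : 0 ≤ ∫ x, h x ^ 2 ∂(jacobiMeasure ψ a b k) := integral_nonneg fun x => sq_nonneg _
  rw [h1, h2, ← h5]
  rw [h4] at h3
  nlinarith [mul_le_mul_of_nonneg_left h3 hc.le, mul_le_mul_of_nonneg_left hle hH]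

/-- The error of the orthogonal projection in `L²_ψ` onto polynomials in `ψ` of degree `< N`. -/
theorem integral_residual_sq_le (A : Admissible ψ a b) {k N : ℕ} (hk : k ≤ N) {c : ℝ}
    (hc : 0 < c) (hcn : ∀ n, N ≤ n → c ≤ jacobiEigenvalue k n) {g h : ℝ → ℝ} {P : ℝ[X]}
    (hg : ∀ j ≤ k, ∃ p, IsDeltaIter ψ a b j g p ∧ MemLp p 2 (jacobiMeasure ψ a b j))
    (hgh : IsDeltaIter ψ a b k g h) (hP : P.degree < N)
    (hgL : MemLp g 2 (psiMeasure ψ a b)) (hhL : MemLp h 2 (jacobiMeasure ψ a b k))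
    (horth : ∀ S : ℝ[X], S.degree < N →
      ∫ x, (g x - P.eval (ψ x)) * S.eval (ψ x) ∂(psiMeasure ψ a b) = 0) :
    c * ∫ x, (g x - P.eval (ψ x)) ^ 2 ∂(psiMeasure ψ a b) ≤
      ∫ x, h x ^ 2 ∂(jacobiMeasure ψ a b k) := by
  set μ := psiMeasure ψ a b with hμ
  set H := ∫ x, h x ^ 2 ∂(jacobiMeasure ψ a b k) with hH
  have hL : ∀ S : ℝ[X], MemLp (fun x => S.eval (ψ x)) 2 μ := fun S => by
    rw [hμ, psiMeasure_eq_jacobiMeasure]; exact A.memLp_eval 0 S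
  set e : ℝ → ℝ := fun x => g x - P.eval (ψ x) with he_def
  have he : MemLp e 2 μ := hgL.sub (hL P)
  set E := ∫ x, e x ^ 2 ∂μ with hE
  have hE0 : 0 ≤ E := integral_nonneg fun x => sq_nonneg _
  have hH0 : 0 ≤ H := integral_nonneg fun x => sq_nonneg _
  have hpos : ∀ n : ℕ, (0 : ℝ) < 1 / ((n : ℝ) + 1) := fun n => by positivity
  choose Q hQ using fun n : ℕ => A.exists_polynomial_integral_sq_le he (hpos n)
  set t : ℕ → ℝ := fun n => ∫ x, e x * (e x - (Q n).eval (ψ x)) ∂μ with ht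
  set r : ℕ → ℝ := fun n => ∫ x, (e x - (Q n).eval (ψ x)) ^ 2 ∂μ with hr
  have hr0 : Tendsto r atTop (𝓝 0) :=
    squeeze_zero (fun n => integral_nonneg fun x => sq_nonneg _) hQ
      tendsto_one_div_add_atTop_nhds_zero_nat
  have ht2 : ∀ n, t n ^ 2 ≤ E * r n := fun n => sq_integral_mul_le he (he.sub (hL (Q n)))
  have ht0 : Tendsto t atTop (𝓝 0) := by
    have h1 : Tendsto (fun n => t n ^ 2) atTop (𝓝 0) :=
      squeeze_zero (fun n => sq_nonneg _) ht2 (by simpa using hr0.const_mul E)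
    have h2 := h1.sqrt
    simp only [Real.sqrt_sq_eq_abs, Real.sqrt_zero] at h2
    exact (tendsto_zero_iff_abs_tendsto_zero _).2 h2
  -- The duality estimate for `Q n`, with both integrals expanded around `Q n = e`; in the limit it
  -- reads `c E² ≤ H E`.
  have hmain : ∀ n, c * (E - t n) ^ 2 ≤ H * (E - 2 * t n + r n) := by
    intro n
    have h1 := A.sq_integral_residual_mul_le hk hc hcn hg hgh hP hgL hhL horth (Q n)
    have i1 : Integrable (fun x => e x ^ 2) μ := he.integrable_sq
    have i2 : Integrable (fun x => e x * (e x - (Q n).eval (ψ x))) μ :=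
      he.integrable_mul (he.sub (hL (Q n)))
    have i3 : Integrable (fun x => (e x - (Q n).eval (ψ x)) ^ 2) μ :=
      (he.sub (hL (Q n))).integrable_sq
    have e1 : ∫ x, e x * (Q n).eval (ψ x) ∂μ = E - t n := by
      rw [hE, ht, ← integral_sub i1 i2]
      refine integral_congr_ae (ae_of_all _ fun x => ?_)
      simp only
      ring
    have e2 : ∫ x, (Q n).eval (ψ x) ^ 2 ∂μ = E - 2 * t n + r n := by
      have i4 : Integrable (fun x => 2 * (e x * (e x - (Q n).eval (ψ x)))) μ := i2.const_mul 2
      have i5 : Integrable (fun x => e x ^ 2 - 2 * (e x * (e x - (Q n).eval (ψ x)))) μ :=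
        i1.sub i4
      rw [hE, ht, hr, ← integral_const_mul, ← integral_sub i1 i4, ← integral_add i5 i3]
      refine integral_congr_ae (ae_of_all _ fun x => ?_)
      simp only
      ring
    rw [e1, e2] at h1
    exact h1
  have hlim : c * (E - 0) ^ 2 ≤ H * (E - 2 * 0 + 0) := by
    refine le_of_tendsto_of_tendsto' (b := atTop) ?_ ?_ hmain
    · exact ((tendsto_const_nhds.sub ht0).pow 2).const_mul c
    · exact ((tendsto_const_nhds.sub (ht0.const_mul 2)).add hr0).const_mul H
  rcases hE0.eq_or_lt with h0 | h0
  · rw [← h0, mul_zero]; exact hH0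
  · simp only [sub_zero, mul_zero, add_zero] at hlim
    have : (c * E) * E ≤ H * E := by linarith [hlim, show c * E ^ 2 = (c * E) * E by ring]
    exact le_of_mul_le_mul_right this h0

end Admissible

/-! ### Fractional integrals of the trial functions and of `L¹_ψ` functions. -/

theorem eval_mem_FSpace (ψ : ℝ → ℝ) {N : ℕ} {P : ℝ[X]} (hP : P.natDegree ≤ N) :
    (fun x => P.eval (ψ x)) ∈ FSpace ψ N := by
  have : (fun x => P.eval (ψ x)) =
      ∑ i ∈ Finset.range (N + 1), P.coeff i • (fun x => ψ x ^ i) := by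
    funext x
    rw [eval_eq_sum_range' (Nat.lt_succ_of_le hP)]
    simp [Finset.sum_apply]
  rw [this]
  refine Submodule.sum_mem _ fun i hi => Submodule.smul_mem _ _ (Submodule.subset_span ⟨i, ?_, rfl⟩)
  exact Nat.lt_succ_iff.1 (Finset.mem_range.1 hi)

theorem exists_polynomial_of_mem_FSpace {N : ℕ} {p : ℝ → ℝ} (hp : p ∈ FSpace ψ N) :
    ∃ P : ℝ[X], P.natDegree ≤ N ∧ p = fun x => P.eval (ψ x) := by
  refine Submodule.span_induction ?_ ?_ ?_ ?_ hp
  · rintro _ ⟨i, hi, rfl⟩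
    exact ⟨X ^ i, (natDegree_X_pow_le i).trans hi, by simp⟩
  · exact ⟨0, by simp, by funext x; simp⟩
  · rintro _ _ _ _ ⟨P, hP, rfl⟩ ⟨Q, hQ, rfl⟩
    exact ⟨P + Q, natDegree_add_le_of_degree_le hP hQ, by funext x; simp⟩
  · rintro c _ _ ⟨P, hP, rfl⟩
    exact ⟨C c * P, (natDegree_C_mul_le c P).trans hP, by funext x; simp⟩

/-- The beta integral with a polynomial factor, scaled to `[0, Y]`. -/
theorem integral_beta_eval {μ : ℝ} (h1 : 1 < μ) (h2 : μ < 2) (Q : ℝ[X]) {Y : ℝ} (hY : 0 < Y) :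
    ∫ s in (0 : ℝ)..Y, (Y - s) ^ (1 - μ) * (s ^ (μ - 1) * Q.eval s) =
      ∑ j ∈ Finset.range (Q.natDegree + 1),
        (Q.coeff j * ∫ t in (0 : ℝ)..1, (1 - t) ^ (1 - μ) * t ^ (μ - 1) * t ^ j) * Y ^ (j + 1) := by
  have hint : ∀ j : ℕ, IntervalIntegrable (fun t : ℝ => (1 - t) ^ (1 - μ) * t ^ (μ - 1) * t ^ j)
      volume 0 1 := by
    intro j
    have e : IntervalIntegrable (fun t : ℝ => (1 - t) ^ (1 - μ)) volume 0 1 := by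
      have := (intervalIntegral.intervalIntegrable_rpow' (a := 0) (b := 1)
        (show (-1 : ℝ) < 1 - μ by linarith)).comp_sub_left 1
      simpa using this.symm
    have hc : Continuous fun t : ℝ => t ^ (μ - 1) * t ^ j :=
      (continuous_id.rpow_const fun x => Or.inr (by linarith)).mul (continuous_pow j)
    simpa only [mul_assoc] using e.mul_continuousOn hc.continuousOn
  have hs := intervalIntegral.mul_integral_comp_mul_left (a := 0) (b := 1)
    (f := fun s : ℝ => (Y - s) ^ (1 - μ) * (s ^ (μ - 1) * Q.eval s)) Y
  rw [mul_zero, mul_one] at hs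
  rw [← hs]
  have hcongr : ∫ t in (0 : ℝ)..1, (Y - Y * t) ^ (1 - μ) * ((Y * t) ^ (μ - 1) * Q.eval (Y * t)) =
      ∫ t in (0 : ℝ)..1, ∑ j ∈ Finset.range (Q.natDegree + 1),
        (Q.coeff j * Y ^ j) * ((1 - t) ^ (1 - μ) * t ^ (μ - 1) * t ^ j) := by
    refine intervalIntegral.integral_congr_ae (ae_of_all _ fun t ht => ?_)
    rw [uIoc_of_le zero_le_one] at ht
    have e1 : Y - Y * t = Y * (1 - t) := by ring
    -- With `s = Y t` the two fractional powers of `Y` cancel, so the result is polynomial in `Y`;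
    -- the substitution contributes one further factor `Y`.
    have e2 : Y ^ (1 - μ) * Y ^ (μ - 1) = 1 := by
      rw [← Real.rpow_add hY]; simp
    rw [e1, Real.mul_rpow hY.le (by linarith [ht.2]), Real.mul_rpow hY.le ht.1.le,
      eval_eq_sum_range, Finset.mul_sum, Finset.mul_sum]
    refine Finset.sum_congr rfl fun j _ => ?_
    rw [mul_pow]
    linear_combination ((1 - t) ^ (1 - μ) * t ^ (μ - 1) * Q.coeff j * Y ^ j * t ^ j) * e2
  rw [hcongr, intervalIntegral.integral_finsetSum fun j _ => (hint j).const_mul _, Finset.mul_sum]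
  refine Finset.sum_congr rfl fun j _ => ?_
  rw [intervalIntegral.integral_const_mul]
  ring

namespace Admissible

theorem image_Ioo (A : Admissible ψ a b) {x : ℝ} (hx : x ∈ Ioc a b) :
    ψ '' Ioo a x = Ioo (ψ a) (ψ x) := by
  have hsub : Icc a x ⊆ Icc a b := Icc_subset_Icc_right hx.2
  refine Subset.antisymm ?_ (intermediate_value_Ioo hx.1.le (A.continuousOn.mono hsub))
  rintro _ ⟨t, ht, rfl⟩
  have h1 := A.strictMonoOn.mono hsub
  exact ⟨h1 (left_mem_Icc.2 hx.1.le) (Ioo_subset_Icc_self ht) ht.1,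
    h1 (Ioo_subset_Icc_self ht) (right_mem_Icc.2 hx.1.le) ht.2⟩

/-- Substitution `s = ψ τ - ψ a`. -/
theorem integral_comp_psi (A : Admissible ψ a b) {x : ℝ} (hx : x ∈ Ioc a b) (G : ℝ → ℝ) :
    ∫ τ in a..x, deriv ψ τ * G (ψ τ - ψ a) = ∫ s in (0 : ℝ)..(ψ x - ψ a), G s := by
  have hsub : Ioo a x ⊆ Ioo a b := Ioo_subset_Ioo_right hx.2
  have hlt : ψ a < ψ x :=
    A.strictMonoOn (left_mem_Icc.2 A.lt.le) (Ioc_subset_Icc_self hx) hx.1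
  have h := integral_image_eq_integral_abs_deriv_smul (s := Ioo a x) (f := ψ) (f' := deriv ψ)
    measurableSet_Ioo (fun t ht => (A.hasDerivAt (hsub ht)).hasDerivWithinAt)
    (A.strictMonoOn.injOn.mono (hsub.trans Ioo_subset_Icc_self)) (fun s => G (s - ψ a))
  rw [A.image_Ioo hx] at h
  rw [intervalIntegral.integral_of_le hx.1.le, integral_Ioc_eq_integral_Ioo]
  have h2 : ∫ s in (0 : ℝ)..(ψ x - ψ a), G s = ∫ s in (ψ a)..(ψ x), G (s - ψ a) := by
    rw [intervalIntegral.integral_comp_sub_right]; simp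
  rw [h2, intervalIntegral.integral_of_le hlt.le, integral_Ioc_eq_integral_Ioo, h]
  refine setIntegral_congr_fun measurableSet_Ioo fun t ht => ?_
  simp only [smul_eq_mul, abs_of_pos (A.deriv_pos (hsub ht))]

/-- The fractional integral of order `2 - μ` maps `(ψ - ψ(a))^{μ-1} P(ψ)` to a polynomial in `ψ`
of one degree more. -/
theorem exists_psiInt_eq_eval (A : Admissible ψ a b) {μ : ℝ} (h1 : 1 < μ) (h2 : μ < 2)
    {φ : ℝ → ℝ} {P : ℝ[X]}
    (hφ : ∀ x ∈ Icc a b, φ x = (ψ x - ψ a) ^ (μ - 1) * P.eval (ψ x)) :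
    ∃ V : ℝ[X], V.natDegree ≤ P.natDegree + 1 ∧
      ∀ x ∈ Icc a b, psiInt ψ a (2 - μ) φ x = V.eval (ψ x) := by
  set Q : ℝ[X] := P.comp (X + C (ψ a)) with hQ
  have hQP : Q.natDegree = P.natDegree := by
    rw [hQ, natDegree_comp, natDegree_X_add_C, mul_one]
  set c : ℕ → ℝ := fun j => ∫ t in (0 : ℝ)..1, (1 - t) ^ (1 - μ) * t ^ (μ - 1) * t ^ j with hc
  refine ⟨C (1 / Real.Gamma (2 - μ)) * ∑ j ∈ Finset.range (Q.natDegree + 1),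
    C (Q.coeff j * c j) * (X - C (ψ a)) ^ (j + 1), ?_, ?_⟩
  · refine (natDegree_C_mul_le _ _).trans (natDegree_sum_le_of_forall_le _ _ fun j hj => ?_)
    refine (natDegree_C_mul_le _ _).trans (natDegree_pow_le.trans ?_)
    rw [natDegree_X_sub_C, mul_one, ← hQP]
    exact Finset.mem_range.1 hj
  · intro x hx
    rw [eval_mul, eval_C, psiInt]
    congr 1
    simp only [eval_finsetSum, eval_mul, eval_C, eval_pow, eval_sub, eval_X]
    rcases hx.1.eq_or_lt with rfl | hax
    · simp
    · have hxI : x ∈ Ioc a b := ⟨hax, hx.2⟩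
      have hlt : ψ a < ψ x := A.strictMonoOn (left_mem_Icc.2 A.lt.le) hx hax
      rw [← integral_beta_eval h1 h2 Q (sub_pos.2 hlt), ← A.integral_comp_psi hxI]
      refine intervalIntegral.integral_congr_ae (ae_of_all _ fun t ht => ?_)
      rw [uIoc_of_le hax.le] at ht
      rw [hφ t ⟨ht.1.le, ht.2.trans hx.2⟩, hQ, eval_comp]
      simp only [eval_add, eval_X, eval_C, sub_add_cancel, sub_sub_sub_cancel_right]
      rw [show 2 - μ - 1 = 1 - μ by ring]
      ring

/-- The kernel of the fractional integral of order `2 - μ` is integrable against `u ∈ L¹_ψ` at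
almost every point. -/
theorem ae_intervalIntegrable_kernel (A : Admissible ψ a b) {μ : ℝ} (h1 : 1 < μ) (h2 : μ < 2)
    {u : ℝ → ℝ} (hu : Integrable u (psiMeasure ψ a b)) :
    ∀ᵐ x ∂(volume.restrict (Ioo a b)), IntervalIntegrable
      (fun τ => deriv ψ τ * (ψ x - ψ τ) ^ (2 - μ - 1) * u τ) volume a x := by
  rw [A.integrable_psiMeasure_iff] at hu
  obtain ⟨c, hc, hlip⟩ := A.exists_mul_sub_le
  have hf : Integrable ((Ioo a b).indicator fun τ => deriv ψ τ * u τ) :=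
    hu.integrable_indicator measurableSet_Ioo
  have hk : Integrable ((Ioo 0 (b - a)).indicator fun s : ℝ => s ^ (2 - μ - 1)) := by
    refine IntegrableOn.integrable_indicator ?_ measurableSet_Ioo
    rw [← intervalIntegrable_iff_integrableOn_Ioo_of_le (sub_pos.2 A.lt).le]
    exact intervalIntegral.intervalIntegrable_rpow' (by linarith)
  -- The kernel is compared with a convolution of two `L¹` functions on the line, which exists
  -- almost everywhere.
  have hconv := hf.ae_convolution_exists (ContinuousLinearMap.mul ℝ ℝ) hk
  filter_upwards [ae_restrict_of_ae hconv, ae_restrict_mem measurableSet_Ioo] with x hx hxI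
  rw [ConvolutionExistsAt] at hx
  rw [intervalIntegrable_iff_integrableOn_Ioo_of_le hxI.1.le]
  have hsub : Ioo a x ⊆ Ioo a b := Ioo_subset_Ioo_right hxI.2.le
  have hx' := (hx.integrableOn (s := Ioo a x)).norm.const_mul (c ^ (2 - μ - 1))
  have hcont : ContinuousOn (fun τ => (ψ x - ψ τ) ^ (2 - μ - 1)) (Ioo a x) := by
    refine ContinuousOn.rpow_const (continuousOn_const.sub
      (A.continuousOn.mono (hsub.trans Ioo_subset_Icc_self))) fun τ hτ => Or.inl ?_
    exact (sub_pos.2 (A.strictMonoOn (Ioo_subset_Icc_self (hsub hτ))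
      (Ioo_subset_Icc_self hxI) hτ.2)).ne'
  refine Integrable.mono' hx' ?_ ?_
  · have := (hu.mono_set hsub).aestronglyMeasurable.mul
      (hcont.aestronglyMeasurable (μ := volume) measurableSet_Ioo)
    refine this.congr (ae_of_all _ fun τ => ?_)
    simp only [Pi.mul_apply]
    ring
  · filter_upwards [ae_restrict_mem measurableSet_Ioo] with τ hτ
    have hp : 0 < x - τ := sub_pos.2 hτ.2
    have hτI := hsub hτ
    have hm : x - τ ∈ Ioo 0 (b - a) := ⟨hp, by linarith [hτ.1, hxI.2]⟩
    rw [ContinuousLinearMap.mul_apply', indicator_of_mem hτI, indicator_of_mem hm]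
    have hψ := hlip τ (Ioo_subset_Icc_self hτI) x (Ioo_subset_Icc_self hxI) hτ.2.le
    -- The exponent `1 - μ` is negative, so the lower Lipschitz bound for `ψ` bounds the kernel from
    -- above.
    have hle : (ψ x - ψ τ) ^ (2 - μ - 1) ≤ c ^ (2 - μ - 1) * (x - τ) ^ (2 - μ - 1) := by
      rw [← Real.mul_rpow hc.le hp.le]
      exact Real.rpow_le_rpow_of_nonpos (by positivity) hψ (by linarith)
    have hpos : 0 ≤ (ψ x - ψ τ) ^ (2 - μ - 1) :=
      Real.rpow_nonneg ((by positivity : 0 ≤ c * (x - τ)).trans hψ) _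
    rw [norm_mul, norm_mul, norm_mul, norm_mul, Real.norm_of_nonneg hpos,
      Real.norm_of_nonneg (Real.rpow_nonneg hp.le _)]
    calc ‖deriv ψ τ‖ * (ψ x - ψ τ) ^ (2 - μ - 1) * ‖u τ‖
        ≤ ‖deriv ψ τ‖ * (c ^ (2 - μ - 1) * (x - τ) ^ (2 - μ - 1)) * ‖u τ‖ := by gcongr
      _ = _ := by ring

theorem psiInt_sub_ae (A : Admissible ψ a b) {μ : ℝ} (h1 : 1 < μ) (h2 : μ < 2)
    {u w : ℝ → ℝ} (hu : Integrable u (psiMeasure ψ a b)) (hw : Integrable w (psiMeasure ψ a b)) :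
    psiInt ψ a (2 - μ) (u - w) =ᵐ[volume.restrict (Ioo a b)]
      fun x => psiInt ψ a (2 - μ) u x - psiInt ψ a (2 - μ) w x := by
  filter_upwards [A.ae_intervalIntegrable_kernel h1 h2 hu,
    A.ae_intervalIntegrable_kernel h1 h2 hw] with x hx1 hx2
  simp only [psiInt, Pi.sub_apply, mul_sub]
  rw [intervalIntegral.integral_sub hx1 hx2, mul_sub]

end Admissible

/-! ### Galerkin orthogonality. -/

theorem exists_derivative_eq (Q : ℝ[X]) :
    ∃ P : ℝ[X], derivative P = Q ∧ P.natDegree ≤ Q.natDegree + 1 := by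
  refine ⟨∑ i ∈ Finset.range (Q.natDegree + 1), C (Q.coeff i / (i + 1)) * X ^ (i + 1), ?_, ?_⟩
  · conv_rhs => rw [Q.as_sum_range_C_mul_X_pow]
    rw [derivative_sum]
    refine Finset.sum_congr rfl fun i _ => ?_
    rw [derivative_C_mul_X_pow]
    congr 2
    push_cast
    field_simp
  · refine natDegree_sum_le_of_forall_le _ _ fun i hi => ?_
    exact (natDegree_C_mul_X_pow_le _ _).trans (Finset.mem_range.1 hi)

namespace Admissible

theorem integral_delta_eq (A : Admissible ψ a b) {v : ℝ → ℝ}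
    (hv : AbsolutelyContinuousOnInterval v a b) :
    ∫ x, delta ψ v x ∂(psiMeasure ψ a b) = v b - v a := by
  rw [A.integral_psiMeasure, ← hv.integral_deriv_eq_sub, intervalIntegral.integral_of_le A.lt.le,
    integral_Ioc_eq_integral_Ioo]
  refine setIntegral_congr_fun measurableSet_Ioo fun x hx => ?_
  simp only [delta]
  rw [mul_div_cancel₀ _ (A.deriv_pos hx).ne']

theorem memLp_psiMeasure_eval (A : Admissible ψ a b) (P : ℝ[X]) :
    MemLp (fun x => P.eval (ψ x)) 2 (psiMeasure ψ a b) := by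
  rw [psiMeasure_eq_jacobiMeasure]; exact A.memLp_eval 0 P

theorem eval_mem_H10 (A : Admissible ψ a b) {P : ℝ[X]} (ha : P.eval (ψ a) = 0)
    (hb : P.eval (ψ b) = 0) : (fun x => P.eval (ψ x)) ∈ H10 ψ a b := by
  refine ⟨A.absolutelyContinuousOnInterval_eval P, ?_, ha, hb⟩
  refine (A.memLp_psiMeasure_eval (derivative P)).ae_eq ?_
  filter_upwards [A.ae_psiMeasure_mem_Ioo] with x hx using (A.delta_eval P hx).symm

/-- The Petrov-Galerkin solution is the projection of the weak solution: the residual is orthogonal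
to polynomials in `ψ` of degree `< N`. -/
theorem exists_galerkin_projection (A : Admissible ψ a b) {μ : ℝ} (h1 : 1 < μ) (h2 : μ < 2)
    {N : ℕ} (hN : 1 ≤ N) {f : Module.Dual ℝ (H10 ψ a b)} {u v uN : ℝ → ℝ}
    (hu : IsWeakSolution ψ a b μ f u v) (huN : IsPetrovGalerkin ψ a b μ N f uN) :
    ∃ V : ℝ[X], (derivative V).degree < N ∧
      psiInt ψ a (2 - μ) (u - uN) =ᵐ[volume.restrict (Ioo a b)] (fun x => v x - V.eval (ψ x)) ∧
      ∀ S : ℝ[X], S.degree < N → ∫ x, (delta ψ v x - (derivative V).eval (ψ x)) * S.eval (ψ x)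
        ∂(psiMeasure ψ a b) = 0 := by
  obtain ⟨hui, hv, huv, hweak⟩ := hu
  obtain ⟨⟨⟨p, hp, hφ⟩, hub⟩, hgal⟩ := huN
  obtain ⟨P, hP, rfl⟩ := exists_polynomial_of_mem_FSpace hp
  obtain ⟨V, hV, hVe⟩ := A.exists_psiInt_eq_eval h1 h2 hφ
  have hVN : V.natDegree ≤ N := by omega
  have hIa : a ∈ Icc a b := left_mem_Icc.2 A.lt.le
  have hIb : b ∈ Icc a b := right_mem_Icc.2 A.lt.le
  have hVa : V.eval (ψ a) = 0 := by rw [← hVe a hIa]; simp [psiInt]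
  have hVb : V.eval (ψ b) = 0 := by rw [← hVe b hIb, hub]
  have hdV : (derivative V).degree < N := by
    rcases eq_or_ne V 0 with rfl | h0
    · simp
    · exact (degree_derivative_lt h0).trans_le (degree_le_of_natDegree_le hVN)
  have huNi : Integrable uN (psiMeasure ψ a b) := by
    have hfin := A.isFiniteMeasure_psiMeasure
    have hc : ContinuousOn (fun x => (ψ x - ψ a) ^ (μ - 1) * P.eval (ψ x)) (Icc a b) :=
      ((A.continuousOn.sub continuousOn_const).rpow_const fun x _ => Or.inr (by linarith)).mul
        (A.continuousOn_eval P)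
    obtain ⟨D, hD⟩ := isCompact_Icc.exists_bound_of_continuousOn hc
    have hi : Integrable (fun x => (ψ x - ψ a) ^ (μ - 1) * P.eval (ψ x)) (psiMeasure ψ a b) := by
      refine Integrable.of_bound (C := D) ?_ ?_
      · exact ((hc.mono Ioo_subset_Icc_self).aestronglyMeasurable measurableSet_Ioo).mono_ac
          (withDensity_absolutelyContinuous _ _)
      · filter_upwards [A.ae_psiMeasure_mem_Ioo] with x hx using hD x (Ioo_subset_Icc_self hx)
    refine hi.congr ?_
    filter_upwards [A.ae_psiMeasure_mem_Ioo] with x hx using (hφ x (Ioo_subset_Icc_self hx)).symm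
  have hdelta : ∀ x ∈ Ioo a b, delta ψ (psiInt ψ a (2 - μ) uN) x = (derivative V).eval (ψ x) := by
    intro x hx
    have : psiInt ψ a (2 - μ) uN =ᶠ[𝓝 x] fun x => V.eval (ψ x) := by
      filter_upwards [Icc_mem_nhds hx.1 hx.2] with y hy using hVe y hy
    rw [delta, this.deriv_eq, ← delta, A.delta_eval V hx]
  refine ⟨V, hdV, ?_, fun S hS => ?_⟩
  · filter_upwards [A.psiInt_sub_ae h1 h2 hui huNi, huv, ae_restrict_mem measurableSet_Ioo] with
      x hx1 hx2 hx
    rw [hx1, hx2, hVe x (Ioo_subset_Icc_self hx)]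
  have hvL : MemLp (delta ψ v) 2 (psiMeasure ψ a b) := hv.2.1
  obtain ⟨T, hT, hTd⟩ := exists_derivative_eq S
  have hSN : S.natDegree < N := by
    rcases eq_or_ne S 0 with rfl | h0
    · simpa using Nat.lt_of_lt_of_le Nat.zero_lt_one hN
    · exact (natDegree_lt_iff_degree_lt h0).2 hS
  -- `B` is a primitive `T` of `S` minus its linear interpolant at the endpoints. It is therefore an
  -- admissible test function, and its derivative is `S` minus its mean `c`.
  set c : ℝ := (T.eval (ψ b) - T.eval (ψ a)) / (ψ b - ψ a) with hc
  set B : ℝ[X] := T - C (T.eval (ψ a)) - C c * (X - C (ψ a)) with hB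
  have hBa : B.eval (ψ a) = 0 := by simp [hB]
  have hBb : B.eval (ψ b) = 0 := by
    have := (sub_pos.2 A.psi_lt).ne'
    simp only [hB, eval_sub, eval_mul, eval_C, eval_X, hc]
    field_simp
    ring
  have hBd : derivative B = S - C c := by simp [hB, hT]
  have hBN : B.natDegree ≤ N := by
    refine (natDegree_sub_le _ _).trans (max_le ((natDegree_sub_le _ _).trans
      (max_le (hTd.trans hSN) (by simp))) ?_)
    refine (natDegree_C_mul_le _ _).trans ?_
    rw [natDegree_X_sub_C]
    exact hN
  let w : H10 ψ a b := ⟨fun x => B.eval (ψ x), A.eval_mem_H10 hBa hBb⟩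
  have e1 := hweak w
  have e2 := hgal w (eval_mem_FSpace ψ hBN)
  have hwd : ∀ x ∈ Ioo a b, delta ψ (w : ℝ → ℝ) x = S.eval (ψ x) - c := fun x hx => by
    rw [A.delta_eval B hx, hBd, eval_sub, eval_C]
  have hκ := A.kappa_pos
  have hwm := A.weightMeasure_eq 0 (α := 0) (by simp)
  rw [← psiMeasure_eq_jacobiMeasure, mul_zero, zero_add, pow_one] at hwm
  rw [hwm, integral_smul_measure, ENNReal.toReal_ofReal hκ.le, smul_eq_mul, ← mul_neg] at e2
  have e3 := mul_left_cancel₀ hκ.ne' e2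
  have hi : ∀ P Q : ℝ[X], Integrable (fun x => P.eval (ψ x) * Q.eval (ψ x)) (psiMeasure ψ a b) :=
    fun P Q => integrable_mul_of_memLp_two (A.memLp_psiMeasure_eval P) (A.memLp_psiMeasure_eval Q)
  have hvi : ∀ Q : ℝ[X], Integrable (fun x => delta ψ v x * Q.eval (ψ x)) (psiMeasure ψ a b) :=
    fun Q => integrable_mul_of_memLp_two hvL (A.memLp_psiMeasure_eval Q)
  have hri : ∀ Q : ℝ[X], Integrable (fun x => (delta ψ v x - (derivative V).eval (ψ x)) *
      Q.eval (ψ x)) (psiMeasure ψ a b) := fun Q => by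
    simp only [sub_mul]; exact (hvi Q).sub (hi _ Q)
  have e4 : ∫ x, (delta ψ v x - (derivative V).eval (ψ x)) * (S - C c).eval (ψ x)
      ∂(psiMeasure ψ a b) = 0 := by
    simp only [sub_mul]
    rw [integral_sub (hvi _) (hi _ _), sub_eq_zero]
    calc _ = ∫ x, delta ψ v x * delta ψ (w : ℝ → ℝ) x ∂(psiMeasure ψ a b) := by
          refine integral_congr_ae ?_
          filter_upwards [A.ae_psiMeasure_mem_Ioo] with x hx
          rw [hwd x hx, eval_sub, eval_C]
      _ = _ := by
          rw [e1, ← e3]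
          refine integral_congr_ae ?_
          filter_upwards [A.ae_psiMeasure_mem_Ioo] with x hx
          rw [hwd x hx, hdelta x hx, eval_sub, eval_C]
  -- No test function produces constants; they are handled by the zero boundary values of `v` and
  -- `V(ψ)`.
  have e5 : ∫ x, (delta ψ v x - (derivative V).eval (ψ x)) * (C c).eval (ψ x)
      ∂(psiMeasure ψ a b) = 0 := by
    simp only [eval_C]
    rw [integral_mul_const, integral_sub]
    · rw [A.integral_delta_eq hv.1, hv.2.2.1, hv.2.2.2]
      have : ∫ x, (derivative V).eval (ψ x) ∂(psiMeasure ψ a b) = 0 := by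
        have h := A.integral_delta_eq (A.absolutelyContinuousOnInterval_eval V)
        rw [hVa, hVb, sub_zero] at h
        rw [← h]
        refine integral_congr_ae ?_
        filter_upwards [A.ae_psiMeasure_mem_Ioo] with x hx using (A.delta_eval V hx).symm
      rw [this]; ring
    · simpa using hvi 1
    · exact A.integrable_eval _
  rw [← add_zero (0 : ℝ)]
  nth_rewrite 1 [← e4]
  rw [← e5, ← integral_add (hri _) (hri _)]
  refine integral_congr_ae (ae_of_all _ fun x => ?_)
  simp only [eval_sub]
  ring

/-! ### Regularity of the weak solution, by the du Bois-Reymond argument. -/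

/-- If `(δ_ψ v, δ_ψ w)_ψ = -(f₀, w)_ψ` for all test functions `w`, then `δ_ψ (δ_ψ v) = f₀`. -/
theorem isDelta_delta_of_weak (A : Admissible ψ a b) {v f₀ : ℝ → ℝ} (hv : v ∈ H10 ψ a b)
    (hf : MemLp f₀ 2 (psiMeasure ψ a b))
    (hweak : ∀ w : H10 ψ a b, ∫ x, delta ψ v x * delta ψ w x ∂(psiMeasure ψ a b) =
      -∫ x, f₀ x * (w : ℝ → ℝ) x ∂(psiMeasure ψ a b)) :
    IsDelta ψ a b (delta ψ v) f₀ := by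
  have hfin := A.isFiniteMeasure_psiMeasure
  have hIa : a ∈ uIcc a b := left_mem_uIcc
  have hfi : IntervalIntegrable (fun x => deriv ψ x * f₀ x) volume a b := by
    rw [intervalIntegrable_iff_integrableOn_Ioo_of_le A.lt.le]
    exact A.integrable_psiMeasure_iff.1 (hf.integrable (by norm_num))
  set G : ℝ → ℝ := fun x => ∫ t in a..x, deriv ψ t * f₀ t with hG
  have hGac : AbsolutelyContinuousOnInterval G a b :=
    hfi.absolutelyContinuousOnInterval_intervalIntegral hIa
  have hmemac : ∀ F : ℝ → ℝ, AbsolutelyContinuousOnInterval F a b →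
      MemLp F 2 (psiMeasure ψ a b) := by
    intro F hF
    have hFc := hF.continuousOn
    rw [uIcc_of_le A.lt.le] at hFc
    obtain ⟨D, hD⟩ := hF.exists_bound
    rw [uIcc_of_le A.lt.le] at hD
    refine MemLp.of_bound ?_ D ?_
    · exact ((hFc.mono Ioo_subset_Icc_self).aestronglyMeasurable measurableSet_Ioo).mono_ac
        (withDensity_absolutelyContinuous _ _)
    · filter_upwards [A.ae_psiMeasure_mem_Ioo] with x hx using hD x (Ioo_subset_Icc_self hx)
  have hderiv : ∀ {q : ℝ → ℝ}, IntervalIntegrable (fun x => deriv ψ x * q x) volume a b →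
      (fun x => delta ψ (fun y => ∫ t in a..y, deriv ψ t * q t) x)
        =ᵐ[volume.restrict (Ioo a b)] q := by
    intro q hq
    filter_upwards [ae_restrict_of_ae hq.ae_hasDerivAt_integral,
      ae_restrict_mem measurableSet_Ioo] with x hx hxI
    have := hx (Icc_subset_uIcc (Ioo_subset_Icc_self hxI)) a hIa
    rw [delta, this.deriv, mul_div_cancel_left₀ _ (A.deriv_pos hxI).ne']
  -- the difference `r` of `δ_ψ v` and the primitive of `f₀` is orthogonal to all `δ_ψ w`
  set r : ℝ → ℝ := fun x => delta ψ v x - G x with hr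
  have hrL : MemLp r 2 (psiMeasure ψ a b) := hv.2.1.sub (hmemac G hGac)
  have horth : ∀ w : H10 ψ a b, ∫ x, r x * delta ψ w x ∂(psiMeasure ψ a b) = 0 := by
    intro w
    have hwac : AbsolutelyContinuousOnInterval (w : ℝ → ℝ) a b := w.2.1
    have hwL : MemLp (delta ψ w) 2 (psiMeasure ψ a b) := w.2.2.1
    have hparts := hGac.integral_mul_deriv_eq_deriv_mul hwac
    rw [w.2.2.2.1, w.2.2.2.2, mul_zero, mul_zero, sub_zero, zero_sub,
      intervalIntegral.integral_of_le A.lt.le, intervalIntegral.integral_of_le A.lt.le,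
      integral_Ioc_eq_integral_Ioo, integral_Ioc_eq_integral_Ioo] at hparts
    have e1 : ∫ x, G x * delta ψ w x ∂(psiMeasure ψ a b) =
        ∫ x in Ioo a b, G x * deriv (w : ℝ → ℝ) x := by
      rw [A.integral_psiMeasure]
      refine setIntegral_congr_fun measurableSet_Ioo fun x hx => ?_
      have := (A.deriv_pos hx).ne'
      simp only [delta]
      field_simp
    have e2 : ∫ x, f₀ x * (w : ℝ → ℝ) x ∂(psiMeasure ψ a b) =
        ∫ x in Ioo a b, deriv G x * (w : ℝ → ℝ) x := by
      rw [A.integral_psiMeasure]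
      refine integral_congr_ae ?_
      filter_upwards [hderiv hfi, ae_restrict_mem measurableSet_Ioo] with x hx hxI
      have h0 := (A.deriv_pos hxI).ne'
      rw [← hx, delta, ← hG]
      field_simp
    simp only [hr, sub_mul]
    rw [integral_sub (integrable_mul_of_memLp_two hv.2.1 hwL)
      (integrable_mul_of_memLp_two (hmemac G hGac) hwL), hweak w, e1, e2, hparts]
    ring
  -- With `m` the mean of `r`, the primitive `w` of `r - m` vanishes at both endpoints. Testing with
  -- it gives `∫ (r - m)² = 0`, so `δ_ψ v = G + m` almost everywhere.
  set m : ℝ := (∫ x, r x ∂(psiMeasure ψ a b)) / (ψ b - ψ a) with hm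
  have hmass : ∫ _ : ℝ, (1 : ℝ) ∂(psiMeasure ψ a b) = ψ b - ψ a := by
    have h := A.integral_delta_eq (A.absolutelyContinuousOnInterval_eval X)
    simp only [eval_X] at h
    rw [← h]
    refine integral_congr_ae ?_
    filter_upwards [A.ae_psiMeasure_mem_Ioo] with x hx
    simpa using (A.delta_eval X hx).symm
  have hcL : MemLp (fun _ : ℝ => m) 2 (psiMeasure ψ a b) := memLp_const m
  have hrmL : MemLp (fun x => r x - m) 2 (psiMeasure ψ a b) := hrL.sub hcL
  have hrm0 : ∫ x, (r x - m) ∂(psiMeasure ψ a b) = 0 := by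
    rw [integral_sub (hrL.integrable (by norm_num)) (hcL.integrable (by norm_num))]
    have : ∫ _ : ℝ, m ∂(psiMeasure ψ a b) = m * (ψ b - ψ a) := by
      rw [← hmass, ← integral_const_mul]; simp
    rw [this, hm, div_mul_cancel₀ _ (sub_pos.2 A.psi_lt).ne', sub_self]
  have hqi : IntervalIntegrable (fun x => deriv ψ x * (r x - m)) volume a b := by
    rw [intervalIntegrable_iff_integrableOn_Ioo_of_le A.lt.le]
    exact A.integrable_psiMeasure_iff.1 (hrmL.integrable (by norm_num))
  set w : ℝ → ℝ := fun x => ∫ t in a..x, deriv ψ t * (r t - m) with hw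
  have hwd : delta ψ w =ᵐ[volume.restrict (Ioo a b)] fun x => r x - m := hderiv hqi
  have hwH : w ∈ H10 ψ a b := by
    refine ⟨hqi.absolutelyContinuousOnInterval_intervalIntegral hIa, ?_, by simp [hw], ?_⟩
    · refine hrmL.ae_eq ?_
      rw [EventuallyEq, A.ae_psiMeasure_eq]
      exact hwd.symm
    · simp only [hw]
      rw [intervalIntegral.integral_of_le A.lt.le, integral_Ioc_eq_integral_Ioo,
        ← A.integral_psiMeasure, hrm0]
  have hsq : ∫ x, (r x - m) ^ 2 ∂(psiMeasure ψ a b) = 0 := by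
    have h1 := horth ⟨w, hwH⟩
    have h2 : ∫ x, r x * (r x - m) ∂(psiMeasure ψ a b) = 0 := by
      rw [← h1]
      refine integral_congr_ae ?_
      rw [EventuallyEq, A.ae_psiMeasure_eq]
      filter_upwards [hwd] with x hx
      simp only [hx]
    have h3 : ∀ x, (r x - m) ^ 2 = r x * (r x - m) - m * (r x - m) := fun x => by ring
    simp only [h3]
    rw [integral_sub (integrable_mul_of_memLp_two hrL hrmL)
      (integrable_mul_of_memLp_two hcL hrmL), h2, integral_const_mul, hrm0]
    ring
  rw [integral_eq_zero_iff_of_nonneg (fun x => sq_nonneg _) hrmL.integrable_sq, EventuallyEq,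
    A.ae_psiMeasure_eq] at hsq
  have hconst : AbsolutelyContinuousOnInterval (fun _ : ℝ => m) a b :=
    (contDiff_const (c := m)).contDiffOn.absolutelyContinuousOnInterval
  refine (isDelta_of_absolutelyContinuousOnInterval (hGac.add hconst)).congr ?_ ?_
  · filter_upwards [hsq] with x hx
    have : r x - m = 0 := by simpa using hx
    simp only [hr] at this
    simp only [Pi.add_apply]
    linarith
  · filter_upwards [delta_add_ae ψ hGac hconst, hderiv hfi] with x hx1 hx
    rw [← hG] at hx
    rw [hx1, hx]
    simp [delta]

end Admissible

/-! ### The estimate in the weighted norms. -/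

/-- All orders `n + μ - 1` share the inner fractional integral of order `2 - μ`, so each of these
derivatives is an iterated `δ_ψ` of the same function. -/
theorem isRLDeriv_iff {ν μ : ℝ} {n : ℕ} (h1 : 1 < μ) (h2 : μ < 2) (hν : ν = n + (μ - 1))
    {u g : ℝ → ℝ} :
    IsRLDeriv ψ a b ν u g ↔ IsDeltaIter ψ a b (n + 1) (psiInt ψ a (2 - μ) u) g := by
  have hfl : ⌊ν⌋₊ = n := by
    rw [Nat.floor_eq_iff (by have : (0 : ℝ) ≤ n := n.cast_nonneg; linarith)]
    constructor <;> linarith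
  rw [IsRLDeriv, hfl, hν]
  have : ((n + 1 : ℕ) : ℝ) - (n + (μ - 1)) = 2 - μ := by push_cast; ring
  rw [this]

namespace Admissible

theorem isDelta_sub_eval (A : Admissible ψ a b) {v : ℝ → ℝ}
    (hv : AbsolutelyContinuousOnInterval v a b) (V : ℝ[X]) :
    IsDelta ψ a b (fun x => v x - V.eval (ψ x))
      (fun x => delta ψ v x - (derivative V).eval (ψ x)) := by
  refine (isDelta_of_absolutelyContinuousOnInterval
    (hv.sub (A.absolutelyContinuousOnInterval_eval V))).congr EventuallyEq.rfl ?_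
  filter_upwards [ae_restrict_of_ae hv.ae_differentiableAt,
    ae_restrict_mem measurableSet_Ioo] with x hx hxI
  have hd := hx (Icc_subset_uIcc (Ioo_subset_Icc_self hxI))
  rw [delta, deriv_sub hd (A.hasDerivAt_eval V hxI).differentiableAt, sub_div,
    ← A.delta_eval V hxI]
  rfl

/-- The projection error in the weighted norms. -/
theorem weightNorm_residual_le (A : Admissible ψ a b) {k N : ℕ} (hN : 1 ≤ N) (hk : k ≤ N)
    {α : ℝ} (hα : α = k) {g h : ℝ → ℝ} {P : ℝ[X]}
    (hg : ∀ j ≤ k, ∃ p, IsDeltaIter ψ a b j g p ∧ MemLp p 2 (jacobiMeasure ψ a b j))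
    (hgh : IsDeltaIter ψ a b k g h) (hP : P.degree < N)
    (hgL : MemLp g 2 (psiMeasure ψ a b)) (hhL : MemLp h 2 (jacobiMeasure ψ a b k))
    (horth : ∀ S : ℝ[X], S.degree < N →
      ∫ x, (g x - P.eval (ψ x)) * S.eval (ψ x) ∂(psiMeasure ψ a b) = 0) :
    weightNorm ψ a b 0 0 (fun x => g x - P.eval (ψ x)) ≤
      ENNReal.ofReal (Real.sqrt ((k : ℝ) ^ k) / kappa ψ a b ^ k * ((N : ℝ) ^ k)⁻¹) *
        weightNorm ψ a b α α h := by
  have hκ := A.kappa_pos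
  have hN0 : (0 : ℝ) < N := by exact_mod_cast hN
  have hkk : (0 : ℝ) < (k : ℝ) ^ k := by
    rcases Nat.eq_zero_or_pos k with rfl | h0
    · simp
    · positivity
  set κ := kappa ψ a b
  have hc : (0 : ℝ) < (N : ℝ) ^ (2 * k) / (k : ℝ) ^ k := by positivity
  have hmain := A.integral_residual_sq_le hk hc (fun n hn => by
    rw [div_le_iff₀ hkk, mul_comm ((jacobiEigenvalue k n : ℕ) : ℝ)]
    exact_mod_cast pow_le_jacobiEigenvalue hk hn) hg hgh hP hgL hhL horth
  have heL : MemLp (fun x => g x - P.eval (ψ x)) 2 (jacobiMeasure ψ a b 0) := by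
    rw [← psiMeasure_eq_jacobiMeasure]
    exact hgL.sub (A.memLp_psiMeasure_eval P)
  rw [A.weightNorm_eq 0 (by simp) heL, A.weightNorm_eq k hα hhL,
    ← ENNReal.ofReal_mul (by positivity), ← psiMeasure_eq_jacobiMeasure]
  refine ENNReal.ofReal_le_ofReal (Real.sqrt_le_iff.2 ⟨by positivity, ?_⟩)
  set E := ∫ x, (g x - P.eval (ψ x)) ^ 2 ∂(psiMeasure ψ a b)
  have hH0 : 0 ≤ ∫ x, h x ^ 2 ∂(jacobiMeasure ψ a b k) := integral_nonneg fun x => sq_nonneg _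
  set H := ∫ x, h x ^ 2 ∂(jacobiMeasure ψ a b k)
  rw [mul_pow, Real.sq_sqrt (by positivity), mul_pow, div_pow, Real.sq_sqrt hkk.le]
  rw [div_mul_eq_mul_div, div_le_iff₀ hkk] at hmain
  -- The weights contribute `κ` on the left and `κ^{2k+1}` on the right; the excess `κ^{2k}`
  -- explains the `κ ^ k` in the constant.
  have : (k : ℝ) ^ k / (κ ^ k) ^ 2 * ((N : ℝ) ^ k)⁻¹ ^ 2 * (κ ^ (2 * k + 1) * H) =
      κ * ((H * (k : ℝ) ^ k) / (N : ℝ) ^ (2 * k)) := by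
    field_simp
    ring
  rw [this]
  simp only [mul_zero, zero_add, pow_one]
  refine mul_le_mul_of_nonneg_left ?_ hκ.le
  rw [le_div_iff₀ (by positivity)]
  linarith

end Admissible

end PsiFrac

end

/-! ### The theorem. -/

open PsiFrac in
theorem theorem4p2 (a b : ℝ) (hab : a < b) (ψ : ℝ → ℝ)
    (hψ : ContDiffOn ℝ 2 ψ (Set.Icc a b))
    (hψ' : ∀ x ∈ Set.Icc a b, 0 < derivWithin ψ (Set.Icc a b) x)
    (m : ℕ) (hm : 1 ≤ m) :
    ∃ C : ℝ, 0 < C ∧ ∀ μ : ℝ, 1 < μ → μ < 2 → ∀ N : ℕ, 1 ≤ N → m ≤ N + 1 →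
      ∀ f ∈ HNegOne ψ a b, ∀ u v uN : ℝ → ℝ,
        IsWeakSolution ψ a b μ f u v → IsPetrovGalerkin ψ a b μ N f uN →
        (MemB ψ a b (m - 1) 0 0 (delta ψ v) →
          ∃ e g : ℝ → ℝ,
            IsRLDeriv ψ a b (μ - 1) (u - uN) e ∧
            IsRLDeriv ψ a b (m + μ - 2) u g ∧
            MemLp g 2 (weightMeasure ψ a b (m - 1) (m - 1)) ∧
            weightNorm ψ a b 0 0 e ≤
              ENNReal.ofReal (C * (N : ℝ) ^ (1 - (m : ℤ))) *
                weightNorm ψ a b (m - 1) (m - 1) g) ∧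
        (2 ≤ m → ∀ f₀ : ℝ → ℝ, Represents ψ a b f₀ f → MemB ψ a b (m - 2) 0 0 f₀ →
          ∃ e g : ℝ → ℝ,
            IsRLDeriv ψ a b (μ - 1) (u - uN) e ∧
            IsDeltaIter ψ a b (m - 2) f₀ g ∧
            MemLp g 2 (weightMeasure ψ a b (m - 1) (m - 1)) ∧
            weightNorm ψ a b 0 0 e ≤
              ENNReal.ofReal (C * (N : ℝ) ^ (1 - (m : ℤ))) *
                weightNorm ψ a b (m - 1) (m - 1) g) := by
  have A : Admissible ψ a b := ⟨hab, hψ, hψ'⟩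
  -- `k = m - 1` is the number of derivatives of `δ_ψ v` in the estimate.
  obtain ⟨k, rfl⟩ := Nat.exists_eq_add_of_le' hm
  have hκ := A.kappa_pos
  have hkk : (0 : ℝ) < (k : ℝ) ^ k := by
    rcases Nat.eq_zero_or_pos k with rfl | h0
    · simp
    · positivity
  refine ⟨Real.sqrt ((k : ℝ) ^ k) / kappa ψ a b ^ k,
    div_pos (Real.sqrt_pos.2 hkk) (pow_pos hκ k), ?_⟩
  intro μ h1 h2 N hN hmN f _ u v uN hu huN
  obtain ⟨V, hV, hVae, horth⟩ := A.exists_galerkin_projection h1 h2 hN hu huN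
  have hv := hu.2.1
  have hα : ((k + 1 : ℕ) : ℝ) - 1 = k := by push_cast; ring
  have hpow : (N : ℝ) ^ (1 - ((k + 1 : ℕ) : ℤ)) = ((N : ℝ) ^ k)⁻¹ := by
    rw [← zpow_natCast, ← zpow_neg]
    congr 1
    push_cast
    ring
  have hk : k ≤ N := by omega
  have he : IsRLDeriv ψ a b (μ - 1) (u - uN)
      (fun x => delta ψ v x - (Polynomial.derivative V).eval (ψ x)) := by
    rw [isRLDeriv_iff (n := 0) h1 h2 (by simp)]
    exact ((A.isDelta_sub_eval hv.1 V).congr hVae.symm Filter.EventuallyEq.rfl).iter_succ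
      Filter.EventuallyEq.rfl
  have hmemB : ∀ {n : ℕ} {g : ℝ → ℝ}, MemB ψ a b n 0 0 g →
      ∀ j ≤ n, ∃ p, IsDeltaIter ψ a b j g p ∧ MemLp p 2 (jacobiMeasure ψ a b j) := by
    intro n g hg j hj
    obtain ⟨p, hp, hpL⟩ := hg j hj
    exact ⟨p, hp, (A.memLp_weightMeasure_iff j (by simp)).1 hpL⟩
  rw [hpow, hα]
  refine ⟨fun hB => ?_, fun h2m f₀ hf₀ hB => ?_⟩
  · rw [Nat.add_sub_cancel] at hB
    have hg := hmemB hB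
    obtain ⟨g, hgk, hgL⟩ := hg k le_rfl
    refine ⟨_, g, he, ?_, (A.memLp_weightMeasure_iff k rfl).2 hgL,
      A.weightNorm_residual_le hN hk rfl hg hgk hV hv.2.1 hgL horth⟩
    rw [isRLDeriv_iff (n := k) h1 h2 (by push_cast; ring)]
    exact ((isDelta_of_absolutelyContinuousOnInterval hv.1).congr hu.2.2.1.symm
      Filter.EventuallyEq.rfl).iter_succ hgk
  · obtain ⟨l, rfl⟩ := Nat.exists_eq_add_of_le' (show 1 ≤ k by omega)
    rw [show l + 1 + 1 - 2 = l by omega] at hB ⊢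
    have hf := hmemB hB
    have hf0 : MemLp f₀ 2 (psiMeasure ψ a b) := by
      obtain ⟨p, hp, hpL⟩ := hf 0 (Nat.zero_le l)
      rw [psiMeasure_eq_jacobiMeasure]
      refine hpL.ae_eq ?_
      rw [Filter.EventuallyEq, A.ae_jacobiMeasure_eq]
      exact Filter.EventuallyEq.symm hp
    have hdd : IsDelta ψ a b (delta ψ v) f₀ :=
      A.isDelta_delta_of_weak hv hf0 fun w => by rw [hu.2.2.2 w, hf₀ w]
    -- Here `δ_ψ^{j+1} (δ_ψ v) = δ_ψ^j f₀` must lie in the space with exponent `j + 1`, while the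
    -- data give exponent `j`; as `quad` is bounded, `memLp_succ` closes this gap.
    have hg : ∀ j ≤ l + 1, ∃ p, IsDeltaIter ψ a b j (delta ψ v) p ∧
        MemLp p 2 (jacobiMeasure ψ a b j) := by
      intro j hj
      rcases j with _ | j
      · refine ⟨_, Filter.EventuallyEq.rfl, ?_⟩
        rw [← psiMeasure_eq_jacobiMeasure]
        exact hv.2.1
      · obtain ⟨p, hp, hpL⟩ := hf j (by omega)
        exact ⟨p, hdd.iter_succ hp, A.memLp_succ j hpL⟩
    obtain ⟨g, hgl, hgL⟩ := hf l le_rfl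
    have hgL' := A.memLp_succ l hgL
    exact ⟨_, g, he, hgl, (A.memLp_weightMeasure_iff (l + 1) rfl).2 hgL',
      A.weightNorm_residual_le hN hk rfl hg (hdd.iter_succ hgl) hV hv.2.1 hgL' horth⟩
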